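/- Let $d\ge 2$ and let $T=\mathbb Z^d$ or $T=\mathbb R^d$. Let $f=(f(x))_{x\in T}$ be a (not necessarily centred or stationary) real Gaussian field, with almost surely continuous sample paths if $T=\mathbb R^d$. Write $B(r)$ for the closed Euclidean ball of radius $r$ centred at the origin of $\mathbb R^d$ and $\partial B(r)$ for its boundary sphere. For $\ell\in\mathbb R$ let $\mathbb P_\ell$ be the law of $f+\ell$, so that, for $A,B\subset\mathbb R^d$, $\mathbb P_\ell[A\longleftrightarrow B]$ is the probability that some path in $\{f+\ell\ge 0\}$ intersects both $A$ and $B$. If $T=\mathbb R^d$, a path is a continuous path; if $T=\mathbb Z^d$, it is a nearest-neighbour lattice path all of whose vertices lie in $\{f+\ell\ge0\}$, regarded as the curve in $\mathbb R^d$ formed by its vertices and the segments joining consecutive vertices. Define \[ \widetilde\ell_c=\sup\Big\{\ell\in\mathbb R:\ \liminf_{R\to\infty}\ \sup_{x\in\mathbb R^d}\mathbb P_\ell\big[x+B(R)\longleftrightarrow x+\partial B(2R)\big]=0\Big\}\in[-\infty,\infty]. \] Assume that local suprema are uniformly bounded: \[ \sup_{x\in T}\mathbb E\Big[\sup_{y\in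 T,\ \|y-x\|_2\le 1}|f(y)|\Big]<\infty . \] Let $g:(0,\infty)\to[0,\infty)$ be non-increasing with \[ |\mathrm{Cov}[f(x),f(y)]|\le g(\|x-y\|_2)\qquad\text{for all distinct }x,y\in T. \] Assume that there exist $\delta>0$ and a non-increasing $h':(0,\infty)\to(0,\infty)$ such that, as $r\to\infty$, \[ h(r):=g(r)(\log r)^{2+\delta}\to0,\qquad \limsup_{r\to\infty}\frac{h(r)}{h'(25r)}<\infty,\qquad \frac{h'(r)^2}{h'(5r)}\to0 . \] Then $\widetilde\ell_c>-\infty$, and for every real $\ell<\widetilde\ell_c$ there exists $c>0$ such that \[ \sup_{x\in\mathbb R^d}\mathbb P_\ell\big[x\longleftrightarrow x+\partial B(R)\big]\le c\,h'(R)\qquad\text{for all }R\ge2 . \] -/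

import Mathlib

open MeasureTheory ProbabilityTheory Filter Topology Set
open scoped ENNReal

namespace GaussPerc

/-- The two kinds of index space of the field: the lattice `ℤ^d` and the continuum `ℝ^d`. -/
inductive Space where
  | lattice
  | continuum

/-- The index space `T`, as a subset of Euclidean space: `ℤ^d` or `ℝ^d`. -/
def Space.pts (T : Space) (d : ℕ) : Set (EuclideanSpace ℝ (Fin d)) :=
  match T with
  | .lattice => {x | ∀ i, ∃ n : ℤ, x i = (n : ℝ)}
  | .continuum => univ

/-- `IsLatticePath S n γ`: the points `γ 0, …, γ n` form a nearest-neighbour path of `ℤ^d`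
all of whose vertices lie in `S`. -/
def IsLatticePath {d : ℕ} (S : Set (EuclideanSpace ℝ (Fin d))) (n : ℕ)
    (γ : ℕ → EuclideanSpace ℝ (Fin d)) : Prop :=
  (∀ i ≤ n, γ i ∈ Space.lattice.pts d ∧ γ i ∈ S) ∧ ∀ i < n, dist (γ i) (γ (i + 1)) = 1

/-- The curve in `ℝ^d` drawn by the path `γ 0, …, γ n`: its vertices together with the line
segments between consecutive vertices. -/
def pathTrace {d : ℕ} (n : ℕ) (γ : ℕ → EuclideanSpace ℝ (Fin d)) :
    Set (EuclideanSpace ℝ (Fin d)) :=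
  {z | (∃ i ≤ n, z = γ i) ∨ ∃ i < n, z ∈ segment ℝ (γ i) (γ (i + 1))}

/-- `T.Connects S A B`: there is a path in `S ⊆ T` (a lattice path if `T = ℤ^d`, a continuous
path if `T = ℝ^d`) that intersects both `A` and `B`. -/
def Space.Connects {d : ℕ} (T : Space) (S A B : Set (EuclideanSpace ℝ (Fin d))) : Prop :=
  match T with
  | .lattice => ∃ (n : ℕ) (γ : ℕ → EuclideanSpace ℝ (Fin d)), IsLatticePath S n γ ∧
      (pathTrace n γ ∩ A).Nonempty ∧ (pathTrace n γ ∩ B).Nonempty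
  | .continuum => ∃ a ∈ A, ∃ b ∈ B, JoinedIn S a b

/-- The excursion set `{x ∈ T : u x + ℓ ≥ 0}`. -/
def excursion {d : ℕ} (T : Space) (u : T.pts d → ℝ) (ℓ : ℝ) : Set (EuclideanSpace ℝ (Fin d)) :=
  {x | ∃ hx : x ∈ T.pts d, 0 ≤ u ⟨x, hx⟩ + ℓ}

/-- `P_ℓ[A ↔ B]`: the probability that `A` and `B` are connected by a path in `{f + ℓ ≥ 0}`. -/
noncomputable def connProb {d : ℕ} (T : Space) {Ω : Type*} [MeasurableSpace Ω] (μ : Measure Ω)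
    (f : T.pts d → Ω → ℝ) (ℓ : ℝ) (A B : Set (EuclideanSpace ℝ (Fin d))) : ℝ≥0∞ :=
  μ {ω | T.Connects (excursion T (fun x => f x ω) ℓ) A B}

/-- The critical level: the supremum in `[-∞, ∞]` of the levels `ℓ` such that
`liminf_{R → ∞} sup_x P_ℓ[x + B(R) ↔ x + ∂B(2R)] = 0`. -/
noncomputable def critLevel {d : ℕ} (T : Space) {Ω : Type*} [MeasurableSpace Ω] (μ : Measure Ω)
    (f : T.pts d → Ω → ℝ) : EReal :=
  sSup ((fun ℓ : ℝ => (ℓ : EReal)) '' {ℓ : ℝ |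
    liminf (fun R : ℝ => ⨆ x : EuclideanSpace ℝ (Fin d),
      connProb T μ f ℓ (Metric.closedBall x R) (Metric.sphere x (2 * R))) atTop = 0})

end GaussPerc

/-! The heart is a sprinkled decoupling inequality, `sprinkled_decoupling`. If two increasing events
depend on the field in regions whose cross-covariances are at most `κ`, then the probability of both
is at most the product of their probabilities at a level raised by `ε`, plus `κ / ε ^ 2`. Each event
is sandwiched between its indicator and the indicator of its raised version by a `1 / ε`-Lipschitz
functional of the field. For bounded Lipschitz functions of jointly Gaussian vectors,
`abs_cov_lipschitz_le` bounds the covariance by `κ L L'`. For the sup norm this bound is free of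
dimension, so it passes from finitely many points to compact regions.

The rest is renormalization. A crossing at scale `25 r` forces crossings of five annuli of scale `r`
at mutual distance at least `r`, chosen from boundedly many positions. Writing `p ℓ r` for the worst
crossing probability, `exists_connProb_le_pow` gives `p ℓ (25 r) ≤ N (p (ℓ + 5 ε) r ^ 5 + 5 g r / ε
^ 2)`. At scale `25 ^ k ρ` one takes `ε` of order `(k + 1) ^ (-(1 + δ / 2))`. These are summable, so
the total sprinkling can be made arbitrarily small, and the error is of order `h`, hence at most of
order `h'` at the next scale. The hypothesis on `h' r ^ 2 / h' (5 r)` gives `h' r ^ 4 ≤ h' (25 r)`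
for large `r`, so a fifth power contracts faster than `h'` can decay. Once `p` is small at one large
scale, it is of order `h'` at a slightly lower level (`exists_forall_le_rate`).

Below the critical level, smallness at one scale comes from the vanishing liminf. At a very low
level it comes from Markov's inequality for the local suprema, which makes the critical level larger
than `-∞`. A final renormalization step, started from a point instead of a ball, gives the one-arm
bound. -/

namespace GaussPerc

/-! ### Smooth approximation of bounded Lipschitz functions -/

section Smooth

variable {E : Type*} [NormedAddCommGroup E] [NormedSpace ℝ E]

/-- Continuous functions bounded by one which have a first-order expansion whose linear part has
norm at most `L` and whose remainder is at most `M ‖h‖ ^ 2`. -/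
structure SmoothLip (L M : ℝ) (Φ : E → ℝ) : Prop where
  cont : Continuous Φ
  abs_le_one : ∀ x, |Φ x| ≤ 1
  expansion : ∃ a : E → StrongDual ℝ E, Continuous a ∧ (∀ x, ‖a x‖ ≤ L) ∧
    ∀ x h, |Φ (x + h) - Φ x - a x h| ≤ M * ‖h‖ ^ 2

lemma abs_remainder_le {M : ℝ} {Φ : E → ℝ} {a : StrongDual ℝ E} {c : ℝ}
    (h : ∀ v, |Φ (0 + v) - Φ 0 - a v| ≤ M * ‖v‖ ^ 2) (hM : 0 ≤ M) {z : E} {t : ℝ}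
    (hz : ‖z‖ ≤ t) :
    |Φ (c • z) - Φ 0 - c * a z| ≤ M * c ^ 2 * t ^ 2 := by
  have := h (c • z)
  rw [zero_add, norm_smul, mul_pow, Real.norm_eq_abs, sq_abs, map_smul, smul_eq_mul] at this
  refine this.trans ?_
  rw [mul_assoc]
  gcongr

variable [FiniteDimensional ℝ E] [MeasurableSpace E] [BorelSpace E]

/-- The expansion is linear in the function, so integrating the linear parts gives an expansion of
the average. The constants do not deteriorate, which allows the operation to be iterated
indefinitely. -/
lemma SmoothLip.average {L M : ℝ} {Φ : E → ℝ} (hΦ : SmoothLip L M Φ) {α : Type*}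
    [MeasurableSpace α] (ρ : Measure α) [IsProbabilityMeasure ρ] {T : α → E} (hT : Measurable T) :
    SmoothLip L M (fun x => ∫ w, Φ (x + T w) ∂ρ) := by
  obtain ⟨a, ha, haL, haM⟩ := hΦ.expansion
  have hmΦ : ∀ x, AEStronglyMeasurable (fun w => Φ (x + T w)) ρ := fun x =>
    (hΦ.cont.measurable.comp (hT.const_add x)).aestronglyMeasurable
  have hiΦ : ∀ x, Integrable (fun w => Φ (x + T w)) ρ := fun x =>
    Integrable.of_bound (hmΦ x) 1 (ae_of_all _ fun w => hΦ.abs_le_one _)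
  have hma : ∀ x, AEStronglyMeasurable (fun w => a (x + T w)) ρ := fun x =>
    (ha.stronglyMeasurable.comp_measurable (hT.const_add x)).aestronglyMeasurable
  have hia : ∀ x, Integrable (fun w => a (x + T w)) ρ := fun x =>
    Integrable.of_bound (hma x) L (ae_of_all _ fun w => haL _)
  refine ⟨?_, fun x => ?_, fun x => ∫ w, a (x + T w) ∂ρ, ?_, fun x => ?_, fun x h => ?_⟩
  · exact continuous_of_dominated hmΦ (fun x => ae_of_all _ fun w => hΦ.abs_le_one _)
      (integrable_const 1) (ae_of_all _ fun w => hΦ.cont.comp (by fun_prop))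
  · simpa using norm_integral_le_of_norm_le_const (μ := ρ) (f := fun w => Φ (x + T w))
      (ae_of_all _ fun w => hΦ.abs_le_one (x + T w))
  · exact continuous_of_dominated hma (fun x => ae_of_all _ fun w => haL _)
      (integrable_const L) (ae_of_all _ fun w => ha.comp (by fun_prop))
  · simpa using norm_integral_le_of_norm_le_const (μ := ρ) (ae_of_all _ fun w => haL (x + T w))
  · rw [ContinuousLinearMap.integral_apply (hia x), ← integral_sub (hiΦ _) (hiΦ _),
      ← integral_sub (f := fun w => Φ (x + h + T w) - Φ (x + T w)) ((hiΦ (x + h)).sub (hiΦ x))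
        ((hia x).apply_continuousLinearMap h)]
    have := norm_integral_le_of_norm_le_const (μ := ρ) (C := M * ‖h‖ ^ 2)
      (f := fun w => Φ (x + h + T w) - Φ (x + T w) - a (x + T w) h)
      (ae_of_all _ fun w => by
        have := haM (x + T w) h
        rwa [show x + h + T w = x + T w + h by abel])
    simpa using this

/-- A bounded Lipschitz function is a uniform limit of smooth ones with the same constants. -/
lemma exists_smoothLip_near {L : ℝ} (hL : 0 ≤ L) {G : E → ℝ} (hG1 : ∀ x, |G x| ≤ 1)
    (hG : ∀ x y, |G x - G y| ≤ L * ‖x - y‖) {η : ℝ} (hη : 0 < η) :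
    ∃ M, 0 ≤ M ∧ ∃ Φ : E → ℝ, SmoothLip L M Φ ∧ ∀ x, |Φ x - G x| ≤ η := by
  let ν : Measure E := Measure.addHaar
  have hr : 0 < η / (L + 1) := by positivity
  -- Moving by the bump radius changes `G` by at most `L * η / (L + 1) ≤ η`; the `+ 1` covers `L =
  -- 0`.
  let φ : ContDiffBump (0 : E) := ⟨η / (L + 1) / 2, η / (L + 1), by positivity, by linarith⟩
  have hGlip : LipschitzWith (Real.toNNReal L) G :=
    LipschitzWith.of_dist_le_mul fun x y => by
      rw [Real.coe_toNNReal L hL, Real.dist_eq, dist_eq_norm]; exact hG x y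
  have hGc : Continuous G := hGlip.continuous
  set ρ : E → ℝ := φ.normed ν with hρ
  have hρc : HasCompactSupport ρ := φ.hasCompactSupport_normed
  have hρd : ContDiff ℝ 1 ρ := φ.contDiff_normed (n := 1)
  have hρi : Integrable ρ ν := φ.integrable_normed
  set B := (ContinuousLinearMap.lsmul ℝ ℝ : ℝ →L[ℝ] ℝ →L[ℝ] ℝ) with hB
  set Φ : E → ℝ := convolution ρ G B ν with hΦ
  have hint : ∀ x, Integrable (fun t => ρ t * G (x - t)) ν := fun x => by
    refine hρi.mul_bdd (c := 1) (hGc.comp (by fun_prop)).aestronglyMeasurable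
      (ae_of_all _ fun t => hG1 _)
  have hΦe : ∀ x, Φ x = ∫ t, ρ t * G (x - t) ∂ν := fun x => rfl
  have hρ1 : ∫ t, ρ t ∂ν = 1 := φ.integral_normed
  have hΦlip : ∀ x y, |Φ x - Φ y| ≤ L * ‖x - y‖ := fun x y => by
    rw [hΦe, hΦe, ← integral_sub (hint x) (hint y), ← Real.norm_eq_abs]
    calc _ ≤ ∫ t, ρ t * (L * ‖x - y‖) ∂ν := by
          refine norm_integral_le_of_norm_le (hρi.mul_const _) (ae_of_all _ fun t => ?_)
          rw [← mul_sub, norm_mul, Real.norm_of_nonneg (φ.nonneg_normed t)]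
          have := hG (x - t) (y - t)
          rw [sub_sub_sub_cancel_right] at this
          exact mul_le_mul_of_nonneg_left this (φ.nonneg_normed t)
      _ = _ := by rw [integral_mul_const, hρ1, one_mul]
  have hΦL : LipschitzWith (Real.toNNReal L) Φ :=
    LipschitzWith.of_dist_le_mul fun x y => by
      rw [Real.coe_toNNReal L hL, Real.dist_eq, dist_eq_norm]; exact hΦlip x y
  set a : E → StrongDual ℝ E := convolution (fderiv ℝ ρ) G (B.precompL E) ν with ha
  have hd : ∀ x, HasFDerivAt Φ (a x) x := fun x =>
    hρc.hasFDerivAt_convolution_left B hρd hGc.locallyIntegrable x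
  have hfc : Continuous (fderiv ℝ ρ) := hρd.continuous_fderiv one_ne_zero
  have hfi : Integrable (fderiv ℝ ρ) ν :=
    hfc.integrable_of_hasCompactSupport (hρc.fderiv ℝ)
  have hBe : ∀ u v, B.precompL E u v = v • u := fun u v => by
    ext g
    simp [hB, mul_comm]
  have hae : ∀ x, a x = ∫ t, G (x - t) • fderiv ℝ ρ t ∂ν := fun x => by
    rw [ha, convolution_def]
    simp only [hBe]
  have haint : ∀ x, Integrable (fun t => G (x - t) • fderiv ℝ ρ t) ν := fun x => by
    refine hfi.norm.mono' ?_ (ae_of_all _ fun t => ?_)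
    · exact ((hGc.comp (by fun_prop : Continuous fun t => x - t)).smul hfc).aestronglyMeasurable
    · rw [norm_smul]
      exact mul_le_of_le_one_left (norm_nonneg _) (hG1 _)
  -- The derivative falls on the bump, so the derivative of the convolution is Lipschitz because `G`
  -- is. This `M` blows up as `η → 0`, which is harmless because the final covariance bound does not
  -- contain it.
  set M := (∫ t, ‖fderiv ℝ ρ t‖ ∂ν) * L with hM
  have hM0 : 0 ≤ M := by
    have : 0 ≤ ∫ t, ‖fderiv ℝ ρ t‖ ∂ν := integral_nonneg fun t => norm_nonneg _
    positivity
  have halip : ∀ x y, ‖a x - a y‖ ≤ M * ‖x - y‖ := fun x y => by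
    rw [hae, hae, ← integral_sub (haint x) (haint y)]
    calc _ ≤ ∫ t, ‖fderiv ℝ ρ t‖ * (L * ‖x - y‖) ∂ν := by
          refine norm_integral_le_of_norm_le (hfi.norm.mul_const _) (ae_of_all _ fun t => ?_)
          have := hG (x - t) (y - t)
          rw [sub_sub_sub_cancel_right] at this
          rw [← sub_smul, norm_smul, mul_comm]
          exact mul_le_mul_of_nonneg_left this (norm_nonneg _)
      _ = _ := by rw [integral_mul_const]; ring
  refine ⟨M, hM0, Φ, ⟨hΦL.continuous, fun x => ?_, a, ?_, fun x => ?_, fun x h => ?_⟩, fun x => ?_⟩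
  · rw [hΦe, ← Real.norm_eq_abs]
    calc _ ≤ ∫ t, ρ t ∂ν := by
          refine norm_integral_le_of_norm_le hρi (ae_of_all _ fun t => ?_)
          rw [norm_mul, Real.norm_of_nonneg (φ.nonneg_normed t)]
          exact mul_le_of_le_one_right (φ.nonneg_normed t) (hG1 _)
      _ = 1 := hρ1
  · exact (LipschitzWith.of_dist_le_mul (K := Real.toNNReal M) fun x y => by
      rw [Real.coe_toNNReal M hM0, dist_eq_norm, dist_eq_norm]; exact halip x y).continuous
  · have := (hd x).le_of_lipschitz hΦL
    rwa [Real.coe_toNNReal L hL] at this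
  · have := Convex.norm_image_sub_le_of_norm_hasFDerivWithin_le' (f := Φ) (f' := a)
      (φ := a x) (C := M * ‖h‖) (s := Metric.closedBall x ‖h‖) (x := x) (y := x + h)
      (fun y _ => (hd y).hasFDerivWithinAt)
      (fun y hy => (halip y x).trans (mul_le_mul_of_nonneg_left
        (by simpa [dist_eq_norm] using hy) hM0))
      (convex_closedBall _ _) (by simp) (by simp)
    rw [add_sub_cancel_left] at this
    rw [← Real.norm_eq_abs]
    refine this.trans (le_of_eq (by ring))
  · rw [← Real.dist_eq]
    refine φ.dist_normed_convolution_le hGc.aestronglyMeasurable fun y hy => ?_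
    rw [Real.dist_eq]
    have hy' : ‖y - x‖ ≤ η / (L + 1) := by
      rw [← dist_eq_norm]; exact (Metric.mem_ball.1 hy).le
    calc |G y - G x| ≤ L * ‖y - x‖ := hG y x
      _ ≤ (L + 1) * (η / (L + 1)) := by gcongr; linarith
      _ = η := by field_simp

end Smooth

/-! ### Gaussian moments and stability under normalized sums -/

section Moments

variable {V : Type*} [NormedAddCommGroup V] [NormedSpace ℝ V] [MeasurableSpace V]
  [BorelSpace V] [CompleteSpace V] [SecondCountableTopology V] {μ : Measure V} [IsGaussian μ]

lemma integrable_norm_pow_gaussian (μ : Measure V) [IsGaussian μ] (k : ℕ) :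
    Integrable (fun z : V => ‖z‖ ^ k) μ := by
  rcases Nat.eq_zero_or_pos k with rfl | hk
  · simp
  · exact (IsGaussian.memLp_id μ k (by simp)).integrable_norm_pow hk.ne'

lemma memLp_two_of_norm_pow_bound {X : V → ℝ} (hX : AEStronglyMeasurable X μ) {A : ℝ} {i : ℕ}
    (h : ∀ z, |X z| ≤ A * ‖z‖ ^ i) : MemLp X 2 μ := by
  rw [memLp_two_iff_integrable_sq hX]
  refine ((integrable_norm_pow_gaussian μ (i * 2)).const_mul (A ^ 2)).mono' (hX.pow 2)
    (ae_of_all _ fun z => ?_)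
  rw [Real.norm_eq_abs, abs_pow, pow_mul, ← mul_pow]
  gcongr
  exact h z

lemma abs_covariance_le_moments {X Y : V → ℝ} (hX : AEStronglyMeasurable X μ)
    (hY : AEStronglyMeasurable Y μ) {A B : ℝ} {i j : ℕ} (hXA : ∀ z, |X z| ≤ A * ‖z‖ ^ i)
    (hYB : ∀ z, |Y z| ≤ B * ‖z‖ ^ j) :
    |cov[X, Y; μ]| ≤ A * B * (∫ z, ‖z‖ ^ (i + j) ∂μ + (∫ z, ‖z‖ ^ i ∂μ) * ∫ z, ‖z‖ ^ j ∂μ) := by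
  rw [covariance_eq_sub (memLp_two_of_norm_pow_bound hX hXA) (memLp_two_of_norm_pow_bound hY hYB)]
  have h1 : |∫ z, X z ∂μ| ≤ A * ∫ z, ‖z‖ ^ i ∂μ := by
    rw [← integral_const_mul, ← Real.norm_eq_abs]
    exact norm_integral_le_of_norm_le ((integrable_norm_pow_gaussian μ i).const_mul A)
      (ae_of_all _ hXA)
  have h2 : |∫ z, Y z ∂μ| ≤ B * ∫ z, ‖z‖ ^ j ∂μ := by
    rw [← integral_const_mul, ← Real.norm_eq_abs]
    exact norm_integral_le_of_norm_le ((integrable_norm_pow_gaussian μ j).const_mul B)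
      (ae_of_all _ hYB)
  have h3 : |∫ z, (X * Y) z ∂μ| ≤ A * B * ∫ z, ‖z‖ ^ (i + j) ∂μ := by
    rw [← integral_const_mul, ← Real.norm_eq_abs]
    refine norm_integral_le_of_norm_le ((integrable_norm_pow_gaussian μ (i + j)).const_mul _)
      (ae_of_all _ fun z => ?_)
    rw [Real.norm_eq_abs, Pi.mul_apply, abs_mul, pow_add]
    calc |X z| * |Y z| ≤ (A * ‖z‖ ^ i) * (B * ‖z‖ ^ j) :=
          mul_le_mul (hXA z) (hYB z) (abs_nonneg _) ((abs_nonneg _).trans (hXA z))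
      _ = _ := by ring
  calc _ ≤ |∫ z, (X * Y) z ∂μ| + |(∫ z, X z ∂μ) * ∫ z, Y z ∂μ| := abs_sub _ _
    _ ≤ A * B * (∫ z, ‖z‖ ^ (i + j) ∂μ) + (A * ∫ z, ‖z‖ ^ i ∂μ) * (B * ∫ z, ‖z‖ ^ j ∂μ) := by
        rw [abs_mul]
        exact add_le_add h3 (mul_le_mul h1 h2 (abs_nonneg _) ((abs_nonneg _).trans h1))
    _ = _ := by ring

/-- A centered Gaussian law is the law of the normalized sum of two independent copies. -/
lemma map_smul_add_gaussian (hμ : μ[id] = 0) :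
    (μ.prod μ).map (fun p : V × V => (√2)⁻¹ • (p.1 + p.2)) = μ := by
  -- The product law is invariant under rotation by `π / 4`; the claim is the first marginal of this
  -- invariance.
  have h := IsGaussian.map_rotation_eq_self hμ (Real.pi / 4)
  have h2 := congrArg (Measure.map Prod.fst) h
  rw [Measure.map_map measurable_fst (by fun_prop)] at h2
  simp only [Measure.map_fst_prod, measure_univ, one_smul] at h2
  convert h2 using 2
  ext p
  have : (√2)⁻¹ = √2 / 2 := by
    rw [inv_eq_one_div, div_eq_div_iff (by positivity) (by positivity)]
    simp
  simp [ContinuousLinearMap.rotation_apply, this, smul_add]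

end Moments
-- Covariance inequality for smooth functions, by repeated halving of the variance
section Covariance

variable {E F : Type*} [NormedAddCommGroup E] [NormedSpace ℝ E] [FiniteDimensional ℝ E]
  [MeasurableSpace E] [BorelSpace E] [NormedAddCommGroup F] [NormedSpace ℝ F]
  [FiniteDimensional ℝ F] [MeasurableSpace F] [BorelSpace F]
  {μ : Measure (E × F)} [IsGaussian μ] {κ L L' M M' : ℝ}

lemma SmoothLip.shift {Φ : E → ℝ} (hΦ : SmoothLip L M Φ) (v : E) :
    SmoothLip L M (fun x => Φ (x + v)) := by
  simpa using hΦ.average (Measure.dirac ()) (T := fun _ => v) measurable_const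

/-- Expand both functions at `0`: the product of the linear parts gives the main term, and every
other pairing is of order at least `c ^ 3` by Gaussian moments. The constant `C` is uniform over the
class, as needed when the functions are replaced by shifts and averages. -/
lemma abs_cov_smoothLip_small (hκ0 : 0 ≤ κ) (hL' : 0 ≤ L')
    (hL : 0 ≤ L) (hM : 0 ≤ M) (hM' : 0 ≤ M')
    (hκ : ∀ (α : StrongDual ℝ E) (β : StrongDual ℝ F),
      |cov[fun z => α z.1, fun z => β z.2; μ]| ≤ κ * ‖α‖ * ‖β‖) :
    ∃ C, ∀ (Φ : E → ℝ) (Ψ : F → ℝ), SmoothLip L M Φ → SmoothLip L' M' Ψ →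
      ∀ c : ℝ, 0 < c → c ≤ 1 →
      |cov[fun z => Φ (c • z.1), fun z => Ψ (c • z.2); μ]| ≤ κ * L * L' * c ^ 2 + C * c ^ 3 := by
  set m : ℕ → ℝ := fun k => ∫ z, ‖z‖ ^ k ∂μ with hm
  have hm0 : ∀ k, 0 ≤ m k := fun k => integral_nonneg fun z => by positivity
  refine ⟨L * M' * (m 3 + m 1 * m 2) + M * L' * (m 3 + m 2 * m 1) + M * M' * (m 4 + m 2 * m 2),
    fun Φ Ψ hΦ hΨ c hc0 hc1 => ?_⟩
  obtain ⟨a, -, haL, haM⟩ := hΦ.expansion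
  obtain ⟨b, -, hbL, hbM⟩ := hΨ.expansion
  let X : E × F → ℝ := fun z => c * a 0 z.1
  let Y : E × F → ℝ := fun z => c * b 0 z.2
  let R : E × F → ℝ := fun z => Φ (c • z.1) - Φ 0 - c * a 0 z.1
  let S : E × F → ℝ := fun z => Ψ (c • z.2) - Ψ 0 - c * b 0 z.2
  have hΦc := hΦ.cont
  have hΨc := hΨ.cont
  have mX : AEStronglyMeasurable X μ := (by fun_prop : Continuous X).aestronglyMeasurable
  have mY : AEStronglyMeasurable Y μ := (by fun_prop : Continuous Y).aestronglyMeasurable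
  have mR : AEStronglyMeasurable R μ := (by fun_prop : Continuous R).aestronglyMeasurable
  have mS : AEStronglyMeasurable S μ := (by fun_prop : Continuous S).aestronglyMeasurable
  have bX : ∀ z, |X z| ≤ c * L * ‖z‖ ^ 1 := fun z => by
    rw [abs_mul, abs_of_pos hc0, pow_one, mul_assoc]
    exact mul_le_mul_of_nonneg_left (((a 0).le_opNorm _).trans
      (mul_le_mul (haL 0) (norm_fst_le z) (norm_nonneg _) hL)) hc0.le
  have bY : ∀ z, |Y z| ≤ c * L' * ‖z‖ ^ 1 := fun z => by
    rw [abs_mul, abs_of_pos hc0, pow_one, mul_assoc]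
    exact mul_le_mul_of_nonneg_left (((b 0).le_opNorm _).trans
      (mul_le_mul (hbL 0) (norm_snd_le z) (norm_nonneg _) hL')) hc0.le
  have bR : ∀ z, |R z| ≤ M * c ^ 2 * ‖z‖ ^ 2 := fun z =>
    abs_remainder_le (haM 0) hM (norm_fst_le z)
  have bS : ∀ z, |S z| ≤ M' * c ^ 2 * ‖z‖ ^ 2 := fun z =>
    abs_remainder_le (hbM 0) hM' (norm_snd_le z)
  have lX := memLp_two_of_norm_pow_bound mX bX
  have lY := memLp_two_of_norm_pow_bound mY bY
  have lR := memLp_two_of_norm_pow_bound mR bR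
  have lS := memLp_two_of_norm_pow_bound mS bS
  have e1 : (fun z : E × F => Φ (c • z.1)) = fun z => (X + R) z + Φ 0 := by
    ext z; simp only [Pi.add_apply, X, R]; ring
  have e2 : (fun z : E × F => Ψ (c • z.2)) = fun z => (Y + S) z + Ψ 0 := by
    ext z; simp only [Pi.add_apply, Y, S]; ring
  rw [e1, e2, covariance_add_const_left ((lX.add lR).integrable (by norm_num)),
    covariance_add_const_right ((lY.add lS).integrable (by norm_num)),
    covariance_add_left lX lR (lY.add lS), covariance_add_right lX lY lS,
    covariance_add_right lR lY lS]
  have hXY : |cov[X, Y; μ]| ≤ κ * L * L' * c ^ 2 := by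
    rw [covariance_const_mul_left, covariance_const_mul_right, ← mul_assoc, abs_mul,
      abs_of_pos (mul_pos hc0 hc0)]
    calc _ ≤ c * c * (κ * ‖a 0‖ * ‖b 0‖) := by gcongr; exact hκ _ _
      _ ≤ c * c * (κ * L * L') := by gcongr; exacts [haL 0, hbL 0]
      _ = _ := by ring
  have hXS := abs_covariance_le_moments mX mS bX bS
  have hRY := abs_covariance_le_moments mR mY bR bY
  have hRS := abs_covariance_le_moments mR mS bR bS
  have hc4 : c ^ 4 ≤ c ^ 3 := pow_le_pow_of_le_one hc0.le hc1 (by norm_num)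
  have h4 : M * M' * (m 4 + m 2 * m 2) * c ^ 4 ≤ M * M' * (m 4 + m 2 * m 2) * c ^ 3 := by
    have := hm0 4
    have := hm0 2
    gcongr
  norm_num only at hXS hRY hRS
  change _ ≤ c * L * (M' * c ^ 2) * (m 3 + m 1 * m 2) at hXS
  change _ ≤ M * c ^ 2 * (c * L') * (m 3 + m 2 * m 1) at hRY
  change _ ≤ M * c ^ 2 * (M' * c ^ 2) * (m 4 + m 2 * m 2) at hRS
  calc _ ≤ |cov[X, Y; μ]| + |cov[X, S; μ]| + (|cov[R, Y; μ]| + |cov[R, S; μ]|) :=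
        (abs_add_le _ _).trans (add_le_add (abs_add_le _ _) (abs_add_le _ _))
    _ ≤ κ * L * L' * c ^ 2 + c * L * (M' * c ^ 2) * (m 3 + m 1 * m 2) +
        (M * c ^ 2 * (c * L') * (m 3 + m 2 * m 1) +
        M * c ^ 2 * (M' * c ^ 2) * (m 4 + m 2 * m 2)) := by gcongr
    _ ≤ _ := by nlinarith [h4]

lemma integral_gaussian_eq_integral_integral {V : Type*} [NormedAddCommGroup V] [NormedSpace ℝ V]
    [MeasurableSpace V] [BorelSpace V] [CompleteSpace V] [SecondCountableTopology V]
    {μ : Measure V} [IsGaussian μ] (hμ : μ[id] = 0) {u : V → ℝ} (hu : Continuous u)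
    (hu1 : ∀ z, |u z| ≤ 1) (c : ℝ) :
    ∫ z, u (c • z) ∂μ =
      ∫ w, ∫ z, u ((c * (√2)⁻¹) • z + (c * (√2)⁻¹) • w) ∂μ ∂μ := by
  conv_lhs => rw [← map_smul_add_gaussian hμ]
  rw [integral_map (by fun_prop) (by fun_prop), integral_prod_symm]
  · simp only [smul_smul, smul_add]
  · exact Integrable.of_bound (by fun_prop) 1 (ae_of_all _ fun z => hu1 _)

lemma cov_of_bounded {Ω : Type*} [MeasurableSpace Ω] {P : Measure Ω} [IsProbabilityMeasure P]
    {X Y : Ω → ℝ} (hX : AEStronglyMeasurable X P) (hY : AEStronglyMeasurable Y P)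
    (hX1 : ∀ z, |X z| ≤ 1) (hY1 : ∀ z, |Y z| ≤ 1) :
    cov[X, Y; P] = ∫ z, X z * Y z ∂P - (∫ z, X z ∂P) * ∫ z, Y z ∂P :=
  covariance_eq_sub (MemLp.of_bound hX 1 (ae_of_all _ hX1)) (MemLp.of_bound hY 1 (ae_of_all _ hY1))

/-- Law of total covariance for `Z = (Z₁ + Z₂) / √2`, conditioning on one summand. The conditional
covariance involves shifts of the functions, and the covariance of the conditional means involves
their averages. Both are instances of `H`, each contributing `e`. -/
lemma abs_cov_smoothLip_double (hμ : μ[id] = 0) {e c : ℝ}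
    (H : ∀ (Φ : E → ℝ) (Ψ : F → ℝ), SmoothLip L M Φ → SmoothLip L' M' Ψ →
      |cov[fun z => Φ ((c * (√2)⁻¹) • z.1), fun z => Ψ ((c * (√2)⁻¹) • z.2); μ]| ≤ e)
    {Φ : E → ℝ} {Ψ : F → ℝ} (hΦ : SmoothLip L M Φ) (hΨ : SmoothLip L' M' Ψ) :
    |cov[fun z => Φ (c • z.1), fun z => Ψ (c • z.2); μ]| ≤ 2 * e := by
  set c' := c * (√2)⁻¹ with hc'
  have hΦc := hΦ.cont
  have hΨc := hΨ.cont
  have hI : ∀ (Φ : E → ℝ) (Ψ : F → ℝ), SmoothLip L M Φ → SmoothLip L' M' Ψ → ∀ c : ℝ,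
      cov[fun z => Φ (c • z.1), fun z => Ψ (c • z.2); μ] =
      ∫ z, Φ (c • z.1) * Ψ (c • z.2) ∂μ - (∫ z, Φ (c • z.1) ∂μ) * ∫ z, Ψ (c • z.2) ∂μ := by
    intro Φ Ψ hΦ hΨ c
    have hΦc := hΦ.cont
    have hΨc := hΨ.cont
    exact cov_of_bounded (by fun_prop) (by fun_prop) (fun z => hΦ.abs_le_one _)
      (fun z => hΨ.abs_le_one _)
  let Φt : E → ℝ := fun x => ∫ z, Φ (x + c' • z.1) ∂μ
  let Ψt : F → ℝ := fun y => ∫ z, Ψ (y + c' • z.2) ∂μ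
  have hΦt : SmoothLip L M Φt := hΦ.average μ (by fun_prop)
  have hΨt : SmoothLip L' M' Ψt := hΨ.average μ (by fun_prop)
  have hΦtc := hΦt.cont
  have hΨtc := hΨt.cont
  have i1 : ∫ z, Φ (c • z.1) ∂μ = ∫ w, Φt (c' • w.1) ∂μ := by
    refine (integral_gaussian_eq_integral_integral hμ (u := fun z => Φ z.1) (by fun_prop)
      (fun z => hΦ.abs_le_one _) c).trans ?_
    simp only [Φt, Prod.fst_add, Prod.smul_fst, add_comm, ← hc']
  have i2 : ∫ z, Ψ (c • z.2) ∂μ = ∫ w, Ψt (c' • w.2) ∂μ := by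
    refine (integral_gaussian_eq_integral_integral hμ (u := fun z => Ψ z.2) (by fun_prop)
      (fun z => hΨ.abs_le_one _) c).trans ?_
    simp only [Ψt, Prod.snd_add, Prod.smul_snd, add_comm, ← hc']
  have hprod : ∀ z : E × F, |Φ z.1 * Ψ z.2| ≤ 1 := fun z => by
    rw [abs_mul]; exact mul_le_one₀ (hΦ.abs_le_one _) (abs_nonneg _) (hΨ.abs_le_one _)
  have i3 : ∫ z, Φ (c • z.1) * Ψ (c • z.2) ∂μ =
      ∫ w, ∫ z, Φ (c' • z.1 + c' • w.1) * Ψ (c' • z.2 + c' • w.2) ∂μ ∂μ :=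
    integral_gaussian_eq_integral_integral hμ (u := fun z => Φ z.1 * Ψ z.2) (by fun_prop) hprod c
  have inner : ∀ w : E × F, |∫ z, Φ (c' • z.1 + c' • w.1) * Ψ (c' • z.2 + c' • w.2) ∂μ -
      Φt (c' • w.1) * Ψt (c' • w.2)| ≤ e := fun w => by
    have := H _ _ (hΦ.shift (c' • w.1)) (hΨ.shift (c' • w.2))
    rw [hI _ _ (hΦ.shift (c' • w.1)) (hΨ.shift (c' • w.2))] at this
    simpa only [Φt, Ψt, add_comm] using this
  have hcI : Continuous fun w : E × F =>
      ∫ z, Φ (c' • z.1 + c' • w.1) * Ψ (c' • z.2 + c' • w.2) ∂μ := by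
    refine continuous_of_dominated (bound := fun _ => 1) (fun w => ?_)
      (fun w => ae_of_all _ fun z => ?_) (integrable_const 1) (ae_of_all _ fun z => by fun_prop)
    · exact (by fun_prop : Continuous _).aestronglyMeasurable
    · exact hprod (c' • z + c' • w)
  have hiI : Integrable (fun w : E × F =>
      ∫ z, Φ (c' • z.1 + c' • w.1) * Ψ (c' • z.2 + c' • w.2) ∂μ) μ :=
    Integrable.of_bound hcI.aestronglyMeasurable 1 (ae_of_all _ fun w => by
      simpa using norm_integral_le_of_norm_le_const (μ := μ)
        (f := fun z => Φ (c' • z.1 + c' • w.1) * Ψ (c' • z.2 + c' • w.2))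
        (ae_of_all _ fun z => hprod (c' • z + c' • w)))
  have hit : Integrable (fun w : E × F => Φt (c' • w.1) * Ψt (c' • w.2)) μ :=
    Integrable.of_bound (by fun_prop) 1 (ae_of_all _ fun w => by
      rw [norm_mul]
      exact mul_le_one₀ (hΦt.abs_le_one _) (abs_nonneg _) (hΨt.abs_le_one _))
  have d1 : |∫ w, ∫ z, Φ (c' • z.1 + c' • w.1) * Ψ (c' • z.2 + c' • w.2) ∂μ ∂μ -
      ∫ w, Φt (c' • w.1) * Ψt (c' • w.2) ∂μ| ≤ e := by
    rw [← integral_sub hiI hit]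
    simpa only [Real.norm_eq_abs, probReal_univ, mul_one] using norm_integral_le_of_norm_le_const
      (μ := μ) (f := fun w => ∫ z, Φ (c' • z.1 + c' • w.1) * Ψ (c' • z.2 + c' • w.2) ∂μ -
        Φt (c' • w.1) * Ψt (c' • w.2)) (ae_of_all _ fun w => inner w)
  have d2 := H _ _ hΦt hΨt
  rw [hI _ _ hΦt hΨt] at d2
  rw [hI _ _ hΦ hΨ, i1, i2, i3]
  calc _ = |(∫ w, ∫ z, Φ (c' • z.1 + c' • w.1) * Ψ (c' • z.2 + c' • w.2) ∂μ ∂μ -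
        ∫ w, Φt (c' • w.1) * Ψt (c' • w.2) ∂μ) + (∫ w, Φt (c' • w.1) * Ψt (c' • w.2) ∂μ -
        (∫ w, Φt (c' • w.1) ∂μ) * ∫ w, Ψt (c' • w.2) ∂μ)| := by ring_nf
    _ ≤ e + e := (abs_add_le _ _).trans (add_le_add d1 d2)
    _ = 2 * e := by ring

/-- After `n` doublings the bound is `2 ^ n` times the small-scale bound at `c = 2 ^ (-n / 2)`. The
quadratic term is reproduced exactly, while the cubic error tends to zero. -/
lemma abs_cov_smoothLip_le (hμ : μ[id] = 0) (hκ0 : 0 ≤ κ) (hL : 0 ≤ L) (hL' : 0 ≤ L')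
    (hM : 0 ≤ M) (hM' : 0 ≤ M')
    (hκ : ∀ (α : StrongDual ℝ E) (β : StrongDual ℝ F),
      |cov[fun z => α z.1, fun z => β z.2; μ]| ≤ κ * ‖α‖ * ‖β‖)
    {Φ : E → ℝ} {Ψ : F → ℝ} (hΦ : SmoothLip L M Φ) (hΨ : SmoothLip L' M' Ψ) :
    |cov[fun z => Φ z.1, fun z => Ψ z.2; μ]| ≤ κ * L * L' := by
  obtain ⟨C, hC⟩ := abs_cov_smoothLip_small hκ0 hL' hL hM hM' hκ
  set s : ℝ := (√2)⁻¹ with hs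
  have hs0 : 0 < s := by positivity
  have hs2 : 2 * s ^ 2 = 1 := by rw [hs, inv_pow, Real.sq_sqrt (by norm_num)]; norm_num
  have hs1 : s < 1 := by nlinarith
  have key : ∀ n : ℕ, ∀ (Φ : E → ℝ) (Ψ : F → ℝ), SmoothLip L M Φ → SmoothLip L' M' Ψ →
      ∀ k : ℕ, |cov[fun z => Φ (s ^ k • z.1), fun z => Ψ (s ^ k • z.2); μ]| ≤
        2 ^ n * (κ * L * L' * (s ^ (k + n)) ^ 2 + C * (s ^ (k + n)) ^ 3) := by
    intro n
    induction n with
    | zero =>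
      intro Φ Ψ hΦ hΨ k
      simpa using hC Φ Ψ hΦ hΨ (s ^ k) (by positivity) (pow_le_one₀ hs0.le hs1.le)
    | succ n ih =>
      intro Φ Ψ hΦ hΨ k
      refine (abs_cov_smoothLip_double hμ (c := s ^ k) (fun Φ Ψ hΦ hΨ => ?_) hΦ hΨ).trans
        (le_of_eq (?_ : 2 * (2 ^ n * (κ * L * L' * (s ^ (k + 1 + n)) ^ 2 +
          C * (s ^ (k + 1 + n)) ^ 3)) = _))
      · have := ih Φ Ψ hΦ hΨ (k + 1)
        rwa [pow_succ] at this
      · rw [show k + 1 + n = k + (n + 1) by ring]; ring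
  have hb : ∀ n : ℕ, |cov[fun z => Φ z.1, fun z => Ψ z.2; μ]| ≤ κ * L * L' + C * s ^ n := by
    intro n
    have := key n Φ Ψ hΦ hΨ 0
    simp only [pow_zero, one_smul, zero_add] at this
    refine this.trans (le_of_eq ?_)
    have h2 : (2 : ℝ) ^ n * (s ^ n) ^ 2 = 1 := by
      rw [← pow_mul, mul_comm n 2, pow_mul, ← mul_pow, hs2, one_pow]
    calc _ = κ * L * L' * (2 ^ n * (s ^ n) ^ 2) + C * s ^ n * (2 ^ n * (s ^ n) ^ 2) := by ring
      _ = _ := by rw [h2]; ring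
  have hlim : Tendsto (fun n : ℕ => κ * L * L' + C * s ^ n) atTop (𝓝 (κ * L * L' + C * 0)) :=
    ((tendsto_pow_atTop_nhds_zero_of_lt_one hs0.le hs1).const_mul C).const_add _
  rw [mul_zero, add_zero] at hlim
  exact ge_of_tendsto' hlim hb

end Covariance
-- Covariance inequality for Lipschitz functions of Gaussian vectors
section Lipschitz

variable {E F : Type*} [NormedAddCommGroup E] [NormedSpace ℝ E] [FiniteDimensional ℝ E]
  [MeasurableSpace E] [BorelSpace E] [NormedAddCommGroup F] [NormedSpace ℝ F]
  [FiniteDimensional ℝ F] [MeasurableSpace F] [BorelSpace F]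
  {μ : Measure (E × F)} [IsGaussian μ] {κ L L' : ℝ}

lemma continuous_of_abs_sub_le {V : Type*} [SeminormedAddCommGroup V] {G : V → ℝ} {L : ℝ}
    (hL : 0 ≤ L) (hG : ∀ x y, |G x - G y| ≤ L * ‖x - y‖) : Continuous G :=
  (LipschitzWith.of_dist_le_mul (K := Real.toNNReal L) fun x y => by
    rw [Real.coe_toNNReal L hL, Real.dist_eq, dist_eq_norm]; exact hG x y).continuous

/-- If two pairs of functions bounded by one are uniformly close then so are their covariances. -/
lemma abs_cov_sub_le {Ω : Type*} [MeasurableSpace Ω] {P : Measure Ω} [IsProbabilityMeasure P]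
    {X Y X' Y' : Ω → ℝ} (hX : AEStronglyMeasurable X P) (hY : AEStronglyMeasurable Y P)
    (hX' : AEStronglyMeasurable X' P) (hY' : AEStronglyMeasurable Y' P)
    (hX1 : ∀ z, |X z| ≤ 1) (hY1 : ∀ z, |Y z| ≤ 1) (hX'1 : ∀ z, |X' z| ≤ 1)
    (hY'1 : ∀ z, |Y' z| ≤ 1) {η : ℝ} (hXX : ∀ z, |X z - X' z| ≤ η) (hYY : ∀ z, |Y z - Y' z| ≤ η) :
    |cov[X, Y; P]| ≤ |cov[X', Y'; P]| + 4 * η := by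
  have memLp : ∀ {Z : Ω → ℝ}, AEStronglyMeasurable Z P → ∀ {b : ℝ}, (∀ z, |Z z| ≤ b) →
      MemLp Z 2 P := fun hZ b hb => MemLp.of_bound hZ b (ae_of_all _ hb)
  have hsmall : ∀ {Z W : Ω → ℝ}, AEStronglyMeasurable Z P → AEStronglyMeasurable W P →
      (∀ z, |Z z| ≤ η) → (∀ z, |W z| ≤ 1) → |cov[Z, W; P]| ≤ 2 * η := by
    intro Z W hZ hW hZη hW1
    rw [covariance_eq_sub (memLp hZ hZη) (memLp hW hW1)]
    have h1 : |∫ z, (Z * W) z ∂P| ≤ η := by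
      simpa using norm_integral_le_of_norm_le_const (μ := P) (f := Z * W) (C := η)
        (ae_of_all _ fun z => by
          rw [Pi.mul_apply, norm_mul, ← mul_one η]
          exact mul_le_mul (hZη z) (hW1 z) (abs_nonneg _) ((abs_nonneg _).trans (hZη z)))
    have h2 : |∫ z, Z z ∂P| ≤ η := by
      simpa using norm_integral_le_of_norm_le_const (μ := P) (f := Z) (ae_of_all _ hZη)
    have h3 : |∫ z, W z ∂P| ≤ 1 := by
      simpa using norm_integral_le_of_norm_le_const (μ := P) (f := W) (ae_of_all _ hW1)
    calc _ ≤ |∫ z, (Z * W) z ∂P| + |(∫ z, Z z ∂P) * ∫ z, W z ∂P| := abs_sub _ _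
      _ ≤ η + η * 1 := by
        rw [abs_mul]
        exact add_le_add h1 (mul_le_mul h2 h3 (abs_nonneg _) ((abs_nonneg _).trans h2))
      _ = 2 * η := by ring
  have e1 : cov[X, Y; P] = cov[X - X', Y; P] + (cov[Y - Y', X'; P] + cov[X', Y'; P]) := by
    rw [covariance_sub_left (memLp hX hX1) (memLp hX' hX'1) (memLp hY hY1),
      covariance_sub_left (memLp hY hY1) (memLp hY' hY'1) (memLp hX' hX'1),
      covariance_comm X' Y', covariance_comm X' Y]
    ring
  rw [e1]
  have h1 := hsmall (hX.sub hX') hY hXX hY1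
  have h2 := hsmall (hY.sub hY') hX' hYY hX'1
  have h3 := abs_add_three (cov[X - X', Y; P]) (cov[Y - Y', X'; P]) (cov[X', Y'; P])
  rw [← add_assoc]
  linarith

/-- **Covariance inequality** for bounded Lipschitz functions of jointly Gaussian vectors. -/
theorem abs_cov_lipschitz_le (hκ0 : 0 ≤ κ) (hL : 0 ≤ L) (hL' : 0 ≤ L')
    (hκ : ∀ (α : StrongDual ℝ E) (β : StrongDual ℝ F),
      |cov[fun z => α z.1, fun z => β z.2; μ]| ≤ κ * ‖α‖ * ‖β‖)
    {G : E → ℝ} {H : F → ℝ} (hG1 : ∀ x, |G x| ≤ 1) (hH1 : ∀ x, |H x| ≤ 1)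
    (hG : ∀ x y, |G x - G y| ≤ L * ‖x - y‖) (hH : ∀ x y, |H x - H y| ≤ L' * ‖x - y‖) :
    |cov[fun z => G z.1, fun z => H z.2; μ]| ≤ κ * L * L' := by
  set m : E × F := μ[id] with hm
  set μ₀ : Measure (E × F) := μ.map (fun z => z - m) with hμ₀
  have hmeas : AEMeasurable (fun z => z - m) μ := by fun_prop
  have hcent : μ₀[id] = 0 := by
    rw [hμ₀, integral_map hmeas (by fun_prop)]
    simp only [id_eq]
    rw [integral_sub IsGaussian.integrable_fun_id (integrable_const _)]
    simp [hm]
  have hGc := continuous_of_abs_sub_le hL hG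
  have hHc := continuous_of_abs_sub_le hL' hH
  have hκ₀ : ∀ (α : StrongDual ℝ E) (β : StrongDual ℝ F),
      |cov[fun z => α z.1, fun z => β z.2; μ₀]| ≤ κ * ‖α‖ * ‖β‖ := fun α β => by
    rw [hμ₀, covariance_map_fun (by fun_prop) (by fun_prop) hmeas]
    simp only [Prod.fst_sub, Prod.snd_sub, map_sub]
    rw [covariance_sub_const_left, covariance_sub_const_right]
    · exact hκ α β
    · exact IsGaussian.integrable_dual μ (β.comp (ContinuousLinearMap.snd ℝ E F))
    · exact IsGaussian.integrable_dual μ (α.comp (ContinuousLinearMap.fst ℝ E F))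
  have e : cov[fun z => G z.1, fun z => H z.2; μ] =
      cov[fun z => G (z.1 + m.1), fun z => H (z.2 + m.2); μ₀] := by
    rw [hμ₀, covariance_map_fun (by fun_prop) (by fun_prop) hmeas]
    simp
  rw [e]
  refine le_of_forall_pos_le_add fun η hη => ?_
  obtain ⟨M, hM, Φ, hΦ, hΦG⟩ := exists_smoothLip_near hL (G := fun x => G (x + m.1))
    (fun x => hG1 _) (fun x y => by simpa using hG (x + m.1) (y + m.1)) (show 0 < η / 4 by linarith)
  obtain ⟨M', hM', Ψ, hΨ, hΨH⟩ := exists_smoothLip_near hL' (G := fun x => H (x + m.2))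
    (fun x => hH1 _) (fun x y => by simpa using hH (x + m.2) (y + m.2)) (show 0 < η / 4 by linarith)
  have hΦc := hΦ.cont
  have hΨc := hΨ.cont
  have h1 := abs_cov_smoothLip_le hcent hκ0 hL hL' hM hM' hκ₀ hΦ hΨ
  have h2 := abs_cov_sub_le (P := μ₀) (X := fun z => G (z.1 + m.1)) (Y := fun z => H (z.2 + m.2))
    (X' := fun z => Φ z.1) (Y' := fun z => Ψ z.2) (by fun_prop) (by fun_prop) (by fun_prop)
    (by fun_prop) (fun z => hG1 _) (fun z => hH1 _) (fun z => hΦ.abs_le_one _)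
    (fun z => hΨ.abs_le_one _) (fun z => by rw [abs_sub_comm]; exact hΦG z.1)
    (fun z => by rw [abs_sub_comm]; exact hΨH z.2)
  linarith

end Lipschitz

/-! ### Finite-dimensional marginals of the field -/

section Marginals

variable {ι Ω : Type*} [MeasurableSpace Ω] {μ : Measure Ω} {f : ι → Ω → ℝ} {κ L L' : ℝ}

/-- Test `α` on the vector of signs of its coefficients, which has sup norm at most one. This
duality is what turns a pointwise covariance bound into one independent of the number of points. -/
lemma sum_abs_dual_le {I : Type*} [Fintype I] [DecidableEq I] (α : StrongDual ℝ (I → ℝ)) :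
    ∑ i, |α (Pi.single i 1)| ≤ ‖α‖ := by
  have h : ∑ i, |α (Pi.single i 1)| = α (fun i => SignType.sign (α (Pi.single i 1))) := by
    conv_rhs => rw [pi_eq_sum_univ' (fun i => ((SignType.sign (α (Pi.single i 1)) : SignType) : ℝ))]
    rw [map_sum]
    refine Finset.sum_congr rfl fun i _ => ?_
    rw [map_smul, smul_eq_mul, ← sign_mul_self]
  rw [h]
  refine (le_abs_self _).trans ((α.le_opNorm _).trans (mul_le_of_le_one_right (norm_nonneg _) ?_))
  refine (pi_norm_le_iff_of_nonneg zero_le_one).2 fun i => ?_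
  rcases SignType.sign (α (Pi.single i 1)) <;> simp

lemma dual_apply_eq_sum {I : Type*} [Fintype I] [DecidableEq I] (α : StrongDual ℝ (I → ℝ))
    (x : I → ℝ) : α x = ∑ i, α (Pi.single i 1) * x i := by
  conv_lhs => rw [pi_eq_sum_univ' x]
  rw [map_sum]
  refine Finset.sum_congr rfl fun i _ => ?_
  rw [map_smul, smul_eq_mul, mul_comm]

lemma abs_cov_restrict_le (hf : IsGaussianProcess f μ) {I J : Finset ι} (hκ0 : 0 ≤ κ)
    (hL : 0 ≤ L) (hL' : 0 ≤ L') (hκ : ∀ x ∈ I, ∀ y ∈ J, |cov[f x, f y; μ]| ≤ κ)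
    {G : (I → ℝ) → ℝ} {H : (J → ℝ) → ℝ} (hG1 : ∀ x, |G x| ≤ 1) (hH1 : ∀ x, |H x| ≤ 1)
    (hG : ∀ x y, |G x - G y| ≤ L * ‖x - y‖) (hH : ∀ x y, |H x - H y| ≤ L' * ‖x - y‖) :
    |cov[fun ω => G (I.restrict (f · ω)), fun ω => H (J.restrict (f · ω)); μ]| ≤ κ * L * L' := by
  classical
  have := hf.isProbabilityMeasure
  -- The two index sets may overlap, so joint Gaussianity is obtained as a linear image of the
  -- marginal on the union.
  let A : ((I ∪ J : Finset ι) → ℝ) →L[ℝ] (I → ℝ) × (J → ℝ) :=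
    (ContinuousLinearMap.pi fun i : I =>
      ContinuousLinearMap.proj ⟨i.1, Finset.mem_union_left _ i.2⟩).prod
    (ContinuousLinearMap.pi fun j : J =>
      ContinuousLinearMap.proj ⟨j.1, Finset.mem_union_right _ j.2⟩)
  have hlaw : HasGaussianLaw (fun ω => (I.restrict (f · ω), J.restrict (f · ω))) μ :=
    (hf.hasGaussianLaw (I ∪ J)).map_fun A
  have hmeas := hlaw.aemeasurable
  have := hlaw.isGaussian_map
  have hGc := continuous_of_abs_sub_le hL hG
  have hHc := continuous_of_abs_sub_le hL' hH
  have h := abs_cov_lipschitz_le (μ := μ.map fun ω => (I.restrict (f · ω), J.restrict (f · ω)))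
    (G := G) (H := H) hκ0 hL hL' (fun α β => ?_) hG1 hH1 hG hH
  · rwa [covariance_map_fun (by fun_prop) (by fun_prop) hmeas] at h
  · rw [covariance_map_fun (by fun_prop) (by fun_prop) hmeas]
    have hm : ∀ x, MemLp (f x) 2 μ := fun x => (hf.hasGaussianLaw_eval x).memLp_two
    have eα : (fun ω => α (I.restrict (f · ω))) =
        fun ω => ∑ i : I, α (Pi.single i 1) * f i ω := funext fun ω => dual_apply_eq_sum α _
    have eβ : (fun ω => β (J.restrict (f · ω))) =
        fun ω => ∑ j : J, β (Pi.single j 1) * f j ω := funext fun ω => dual_apply_eq_sum β _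
    simp only [eα, eβ]
    rw [covariance_fun_sum_fun_sum (fun i : I => (hm i).const_mul _)
      (fun j : J => (hm j).const_mul _)]
    calc _ ≤ ∑ i : I, ∑ j : J, |α (Pi.single i 1)| * (|β (Pi.single j 1)| * κ) := by
          refine (Finset.abs_sum_le_sum_abs _ _).trans (Finset.sum_le_sum fun i _ => ?_)
          refine (Finset.abs_sum_le_sum_abs _ _).trans (Finset.sum_le_sum fun j _ => ?_)
          rw [covariance_const_mul_left, covariance_const_mul_right, abs_mul, abs_mul]
          gcongr
          exact hκ _ i.2 _ j.2
      _ = κ * (∑ i : I, |α (Pi.single i 1)|) * ∑ j : J, |β (Pi.single j 1)| := by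
          simp_rw [← Finset.mul_sum, ← Finset.sum_mul]
          ring
      _ ≤ _ := by
          gcongr
          exacts [sum_abs_dual_le α, sum_abs_dual_le β]

end Marginals
-- Sprinkled decoupling of increasing events
section Decoupling

variable {ι : Type*}

/-- `F` takes values in `[0, 1]`, and moves by at most `L t` when its argument moves by at most `t`
on `D`. -/
structure LocalLip (D : Set ι) (L : ℝ) (F : (ι → ℝ) → ℝ) : Prop where
  nonneg : ∀ u, 0 ≤ F u
  le_one : ∀ u, F u ≤ 1
  abs_sub_le : ∀ u v t, 0 ≤ t → (∀ x ∈ D, |u x - v x| ≤ t) → |F u - F v| ≤ L * t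

lemma LocalLip.abs_le_one {D : Set ι} {L : ℝ} {F : (ι → ℝ) → ℝ} (hF : LocalLip D L F) (u) :
    |F u| ≤ 1 := abs_le.2 ⟨by linarith [hF.nonneg u], hF.le_one u⟩

/-- The event `C` is increasing and only depends on the values on `D`. -/
def IncreasingOn (D : Set ι) (C : (ι → ℝ) → Prop) : Prop :=
  ∀ u v, (∀ x ∈ D, u x ≤ v x) → C u → C v

lemma IncreasingOn.add_const {D : Set ι} {C : (ι → ℝ) → Prop} (hC : IncreasingOn D C) (c : ℝ) :
    IncreasingOn D fun u => C fun x => u x + c :=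
  fun u v huv h => hC _ _ (fun x hx => by linarith [huv x hx]) h

lemma IncreasingOn.forall_mem {I : Type*} {D : I → Set ι} {C : I → (ι → ℝ) → Prop}
    (hC : ∀ i, IncreasingOn (D i) (C i)) (s : Finset I) :
    IncreasingOn (⋃ i ∈ s, D i) fun u => ∀ i ∈ s, C i u :=
  fun u v huv h i hi => hC i u v (fun x hx => huv x (mem_biUnion hi hx)) (h i hi)

/-- The fraction of the levels in `[0, ε]` at which `C` occurs. -/
noncomputable def levelFraction (C : (ι → ℝ) → Prop) (ε : ℝ) (u : ι → ℝ) : ℝ :=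
  sSup {t | 0 ≤ t ∧ t ≤ 1 ∧ (t = 0 ∨ C fun x => u x + ε * (1 - t))}

lemma levelFraction_bddAbove (C : (ι → ℝ) → Prop) (ε : ℝ) (u : ι → ℝ) :
    BddAbove {t | 0 ≤ t ∧ t ≤ 1 ∧ (t = 0 ∨ C fun x => u x + ε * (1 - t))} :=
  ⟨1, fun _ ht => ht.2.1⟩

lemma levelFraction_nonneg (C : (ι → ℝ) → Prop) (ε : ℝ) (u : ι → ℝ) : 0 ≤ levelFraction C ε u :=
  le_csSup (levelFraction_bddAbove C ε u) ⟨le_rfl, zero_le_one, Or.inl rfl⟩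

/-- Perturbing the field by `t` on `D` can be compensated by changing the level by `t`, that is, by
a fraction `t / ε` of the interval `[0, ε]`. -/
lemma levelFraction_localLip {D : Set ι} {C : (ι → ℝ) → Prop} (hC : IncreasingOn D C) {ε : ℝ}
    (hε : 0 < ε) : LocalLip D ε⁻¹ (levelFraction C ε) := by
  have hstep : ∀ u v t, 0 ≤ t → (∀ x ∈ D, |u x - v x| ≤ t) →
      levelFraction C ε u ≤ levelFraction C ε v + ε⁻¹ * t := by
    intro u v t ht huv
    refine csSup_le ⟨0, le_rfl, zero_le_one, Or.inl rfl⟩ ?_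
    rintro s ⟨hs0, hs1, hs⟩
    have hv0 := levelFraction_nonneg C ε v
    have hεt : 0 ≤ ε⁻¹ * t := by positivity
    rcases hs with rfl | hs
    · positivity
    rcases le_or_gt s (ε⁻¹ * t) with hst | hst
    · linarith
    rw [← sub_le_iff_le_add]
    refine le_csSup (levelFraction_bddAbove C ε v) ⟨by linarith, by linarith, Or.inr ?_⟩
    refine hC _ _ (fun x hx => ?_) hs
    have h1 := (abs_le.1 (huv x hx)).2
    have h2 : ε * (ε⁻¹ * t) = t := by field_simp
    nlinarith
  refine ⟨levelFraction_nonneg C ε, fun u => csSup_le ⟨0, le_rfl, zero_le_one, Or.inl rfl⟩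
    fun t ht => ht.2.1, fun u v t ht huv => abs_le.2 ⟨?_, ?_⟩⟩
  · linarith [hstep v u t ht fun x hx => by rw [abs_sub_comm]; exact huv x hx]
  · linarith [hstep u v t ht huv]

lemma one_le_levelFraction {C : (ι → ℝ) → Prop} {ε : ℝ} {u : ι → ℝ} (hu : C u) :
    1 ≤ levelFraction C ε u :=
  le_csSup (levelFraction_bddAbove C ε u) ⟨zero_le_one, le_rfl, Or.inr (by simpa using hu)⟩

lemma of_levelFraction_pos {D : Set ι} {C : (ι → ℝ) → Prop} (hC : IncreasingOn D C) {ε : ℝ}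
    (hε : 0 < ε) {u : ι → ℝ} (hu : 0 < levelFraction C ε u) : C fun x => u x + ε := by
  obtain ⟨t, ⟨ht0, ht1, ht⟩, htp⟩ := exists_lt_of_lt_csSup
    (s := {t | 0 ≤ t ∧ t ≤ 1 ∧ (t = 0 ∨ C fun x => u x + ε * (1 - t))})
    ⟨0, le_rfl, zero_le_one, Or.inl rfl⟩ hu
  rcases ht with rfl | ht
  · exact absurd htp (lt_irrefl _)
  · exact hC _ _ (fun x _ => by nlinarith) ht

variable [PseudoMetricSpace ι]

/-- Sample the field on a finite net of `D` and extend it to `D` by the value at a nearby net point.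
Uniform continuity gives convergence, and the sup-norm Lipschitz constant stays `L` on every net. -/
lemma LocalLip.exists_finite_approx {D : Set ι} (hD : IsCompact D) {L : ℝ} {F : (ι → ℝ) → ℝ}
    (hF : LocalLip D L F) :
    ∃ (I : ℕ → Finset ι) (G : ∀ n, (I n → ℝ) → ℝ), (∀ n, ∀ x ∈ I n, x ∈ D) ∧
      (∀ n w, |G n w| ≤ 1) ∧ (∀ n w w', |G n w - G n w'| ≤ L * ‖w - w'‖) ∧
      ∀ u, Continuous u → Tendsto (fun n => G n ((I n).restrict u)) atTop (𝓝 (F u)) := by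
  classical
  have hcov : ∀ n : ℕ, ∃ I : Finset ι, (∀ x ∈ I, x ∈ D) ∧
      ∀ x ∈ D, ∃ y ∈ I, dist x y < 1 / ((n : ℝ) + 1) := fun n => by
    obtain ⟨t, htD, htf, ht⟩ := hD.finite_cover_balls (e := 1 / ((n : ℝ) + 1)) (by positivity)
    refine ⟨htf.toFinset, fun x hx => htD (by simpa using hx), fun x hx => ?_⟩
    obtain ⟨y, hy, hxy⟩ := mem_iUnion₂.1 (ht hx)
    exact ⟨y, by simpa using hy, hxy⟩
  choose I hID π hπI hπ using hcov
  let e : ∀ n, (I n → ℝ) → ι → ℝ := fun n w x =>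
    if hx : x ∈ D then w ⟨π n x hx, hπI n x hx⟩ else 0
  refine ⟨I, fun n w => F (e n w), hID, fun n w => hF.abs_le_one _, fun n w w' => ?_,
    fun u hu => ?_⟩
  · refine hF.abs_sub_le _ _ _ (norm_nonneg _) fun x hx => ?_
    simp only [e, hx, dif_pos]
    exact norm_le_pi_norm (w - w') ⟨π n x hx, hπI n x hx⟩
  · have huc := hD.uniformContinuousOn_of_continuous hu.continuousOn
    rw [Metric.uniformContinuousOn_iff_le] at huc
    rw [Metric.tendsto_atTop]
    intro η hη
    obtain ⟨r, hr, hur⟩ := huc (η / (|L| + 1)) (by positivity)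
    obtain ⟨N, hN⟩ := exists_nat_one_div_lt hr
    refine ⟨N, fun n hn => ?_⟩
    have hb : ∀ x ∈ D, |e n ((I n).restrict u) x - u x| ≤ η / (|L| + 1) := fun x hx => by
      simp only [e, hx, dif_pos, Finset.restrict]
      rw [← Real.dist_eq, dist_comm]
      refine hur x hx _ (hID n _ (hπI n x hx)) ((hπ n x hx).le.trans (le_trans ?_ hN.le))
      gcongr
    have := hF.abs_sub_le _ _ _ (by positivity) hb
    rw [Real.dist_eq]
    refine this.trans_lt ?_
    rw [mul_div_assoc', div_lt_iff₀ (by positivity)]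
    nlinarith [le_abs_self L]

variable {Ω : Type*} [MeasurableSpace Ω] {μ : Measure Ω} {f : ι → Ω → ℝ} {κ L L' : ℝ}

lemma LocalLip.aemeasurable (hf : ∀ x, AEMeasurable (f x) μ)
    (hcont : ∀ᵐ ω ∂μ, Continuous fun x => f x ω) {D : Set ι} (hD : IsCompact D) (hL : 0 ≤ L)
    {F : (ι → ℝ) → ℝ} (hF : LocalLip D L F) : AEMeasurable (fun ω => F fun x => f x ω) μ := by
  obtain ⟨I, G, -, -, hG, hlim⟩ := hF.exists_finite_approx hD
  refine aemeasurable_of_tendsto_metrizable_ae' (f := fun n ω => G n ((I n).restrict (f · ω)))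
    (fun n => ?_) ?_
  · exact (continuous_of_abs_sub_le hL (hG n)).measurable.comp_aemeasurable
      (aemeasurable_pi_lambda _ fun i => hf i)
  · filter_upwards [hcont] with ω hω using hlim _ hω

lemma abs_cov_localLip_le (hf : IsGaussianProcess f μ)
    (hcont : ∀ᵐ ω ∂μ, Continuous fun x => f x ω) {D D' : Set ι} (hD : IsCompact D)
    (hD' : IsCompact D') (hκ0 : 0 ≤ κ) (hL : 0 ≤ L) (hL' : 0 ≤ L')
    (hκ : ∀ x ∈ D, ∀ y ∈ D', |cov[f x, f y; μ]| ≤ κ) {F F' : (ι → ℝ) → ℝ}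
    (hF : LocalLip D L F) (hF' : LocalLip D' L' F') :
    |cov[fun ω => F (f · ω), fun ω => F' (f · ω); μ]| ≤ κ * L * L' := by
  have := hf.isProbabilityMeasure
  obtain ⟨I, G, hI, hG1, hG, hlim⟩ := hF.exists_finite_approx hD
  obtain ⟨I', G', hI', hG1', hG', hlim'⟩ := hF'.exists_finite_approx hD'
  have mG : ∀ n, AEStronglyMeasurable (fun ω => G n ((I n).restrict (f · ω))) μ := fun n =>
    ((continuous_of_abs_sub_le hL (hG n)).measurable.comp_aemeasurable
      (aemeasurable_pi_lambda _ fun i => hf.aemeasurable i)).aestronglyMeasurable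
  have mG' : ∀ n, AEStronglyMeasurable (fun ω => G' n ((I' n).restrict (f · ω))) μ := fun n =>
    ((continuous_of_abs_sub_le hL' (hG' n)).measurable.comp_aemeasurable
      (aemeasurable_pi_lambda _ fun i => hf.aemeasurable i)).aestronglyMeasurable
  have mF := (hF.aemeasurable hf.aemeasurable hcont hD hL).aestronglyMeasurable
  have mF' := (hF'.aemeasurable hf.aemeasurable hcont hD' hL').aestronglyMeasurable
  have hn : ∀ n, |cov[fun ω => G n ((I n).restrict (f · ω)),
      fun ω => G' n ((I' n).restrict (f · ω)); μ]| ≤ κ * L * L' := fun n =>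
    abs_cov_restrict_le hf hκ0 hL hL' (fun x hx y hy => hκ x (hI n x hx) y (hI' n y hy))
      (hG1 n) (hG1' n) (hG n) (hG' n)
  rw [cov_of_bounded mF mF' (fun _ => hF.abs_le_one _) (fun _ => hF'.abs_le_one _)]
  refine le_of_tendsto (f := fun n => |cov[fun ω => G n ((I n).restrict (f · ω)),
      fun ω => G' n ((I' n).restrict (f · ω)); μ]|) (x := atTop) ?_ (Eventually.of_forall hn)
  simp_rw [fun n => cov_of_bounded (mG n) (mG' n) (fun _ => hG1 n _) (fun _ => hG1' n _)]
  refine ((Tendsto.sub ?_ (Tendsto.mul ?_ ?_))).abs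
  · refine tendsto_integral_of_dominated_convergence (fun _ => 1) (fun n => (mG n).mul (mG' n))
      (integrable_const 1) (fun n => ae_of_all _ fun ω => ?_) ?_
    · rw [norm_mul]
      exact mul_le_one₀ (hG1 n _) (abs_nonneg _) (hG1' n _)
    · filter_upwards [hcont] with ω hω using (hlim _ hω).mul (hlim' _ hω)
  · refine tendsto_integral_of_dominated_convergence (fun _ => 1) mG
      (integrable_const 1) (fun n => ae_of_all _ fun ω => hG1 n _) ?_
    filter_upwards [hcont] with ω hω using hlim _ hω
  · refine tendsto_integral_of_dominated_convergence (fun _ => 1) mG'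
      (integrable_const 1) (fun n => ae_of_all _ fun ω => hG1' n _) ?_
    filter_upwards [hcont] with ω hω using hlim' _ hω

/-- **Sprinkled decoupling inequality** for increasing events of a Gaussian field. -/
theorem sprinkled_decoupling (hf : IsGaussianProcess f μ)
    (hcont : ∀ᵐ ω ∂μ, Continuous fun x => f x ω) {D D' : Set ι} (hD : IsCompact D)
    (hD' : IsCompact D') (hκ0 : 0 ≤ κ) (hκ : ∀ x ∈ D, ∀ y ∈ D', |cov[f x, f y; μ]| ≤ κ)
    {C C' : (ι → ℝ) → Prop} (hC : IncreasingOn D C) (hC' : IncreasingOn D' C') {ε : ℝ}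
    (hε : 0 < ε) :
    μ {ω | C (fun x => f x ω) ∧ C' (fun x => f x ω)} ≤
      μ {ω | C fun x => f x ω + ε} * μ {ω | C' fun x => f x ω + ε} +
        ENNReal.ofReal (κ / ε ^ 2) := by
  have := hf.isProbabilityMeasure
  have hε' : 0 ≤ ε⁻¹ := by positivity
  have hF := levelFraction_localLip hC hε
  have hF' := levelFraction_localLip hC' hε
  set X : Ω → ℝ := fun ω => levelFraction C ε (f · ω) with hX
  set Y : Ω → ℝ := fun ω => levelFraction C' ε (f · ω) with hY
  have mX : AEMeasurable X μ := hF.aemeasurable hf.aemeasurable hcont hD hε'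
  have mY : AEMeasurable Y μ := hF'.aemeasurable hf.aemeasurable hcont hD' hε'
  have hX0 : ∀ ω, 0 ≤ X ω := fun ω => hF.nonneg _
  have hY0 : ∀ ω, 0 ≤ Y ω := fun ω => hF'.nonneg _
  have hX1 : ∀ ω, X ω ≤ 1 := fun ω => hF.le_one _
  have hY1 : ∀ ω, Y ω ≤ 1 := fun ω => hF'.le_one _
  have hcov := abs_cov_localLip_le hf hcont hD hD' hκ0 hε' hε' hκ hF hF'
  rw [cov_of_bounded mX.aestronglyMeasurable mY.aestronglyMeasurable
    (fun _ => hF.abs_le_one _) (fun _ => hF'.abs_le_one _)] at hcov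
  have hprod : ∫ ω, X ω * Y ω ∂μ ≤ (∫ ω, X ω ∂μ) * (∫ ω, Y ω ∂μ) + κ / ε ^ 2 := by
    have h := (abs_le.1 hcov).2
    have e : κ * ε⁻¹ * ε⁻¹ = κ / ε ^ 2 := by field_simp
    linarith
  have hlin : ∀ {Z : Ω → ℝ}, AEMeasurable Z μ → (∀ ω, 0 ≤ Z ω) → (∀ ω, Z ω ≤ 1) →
      ENNReal.ofReal (∫ ω, Z ω ∂μ) = ∫⁻ ω, ENNReal.ofReal (Z ω) ∂μ := fun hZ h0 h1 =>
    ofReal_integral_eq_lintegral_ofReal (Integrable.of_bound hZ.aestronglyMeasurable 1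
      (ae_of_all _ fun ω => by rw [Real.norm_of_nonneg (h0 ω)]; exact h1 ω)) (ae_of_all _ h0)
  have hupper : ∀ {Z : Ω → ℝ} {A : Set Ω}, AEMeasurable Z μ → (∀ ω, 0 ≤ Z ω) → (∀ ω, Z ω ≤ 1) →
      (∀ ω, 0 < Z ω → ω ∈ A) → ENNReal.ofReal (∫ ω, Z ω ∂μ) ≤ μ A := fun {Z A} hZ h0 h1 hA => by
    rw [hlin hZ h0 h1]
    -- Connection events are not assumed measurable, so the bound goes through a measurable hull of
    -- the same measure.
    calc _ ≤ ∫⁻ ω, (toMeasurable μ A).indicator 1 ω ∂μ := by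
          refine lintegral_mono fun ω => ?_
          by_cases hω : ω ∈ toMeasurable μ A
          · simpa [hω] using h1 ω
          · have : ¬ 0 < Z ω := fun h => hω (subset_toMeasurable μ A (hA ω h))
            simp [hω, not_lt.1 this]
      _ = μ A := by
          rw [lintegral_indicator_one (measurableSet_toMeasurable μ A), measure_toMeasurable]
  calc μ {ω | C (fun x => f x ω) ∧ C' (fun x => f x ω)}
      ≤ μ {ω | 1 ≤ ENNReal.ofReal (X ω * Y ω)} := by
        refine measure_mono fun ω hω => ?_
        have h1 : 1 ≤ X ω := one_le_levelFraction hω.1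
        have h2 : 1 ≤ Y ω := one_le_levelFraction hω.2
        rw [mem_ofPred_eq, ENNReal.one_le_ofReal]
        nlinarith
    _ ≤ ∫⁻ ω, ENNReal.ofReal (X ω * Y ω) ∂μ := by
        simpa using meas_ge_le_lintegral_div (μ := μ) (mX.mul mY).ennreal_ofReal
          one_ne_zero ENNReal.one_ne_top
    _ = ENNReal.ofReal (∫ ω, X ω * Y ω ∂μ) :=
        (hlin (mX.mul mY) (fun ω => mul_nonneg (hX0 ω) (hY0 ω))
          (fun ω => mul_le_one₀ (hX1 ω) (hY0 ω) (hY1 ω))).symm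
    _ ≤ ENNReal.ofReal ((∫ ω, X ω ∂μ) * (∫ ω, Y ω ∂μ) + κ / ε ^ 2) :=
        ENNReal.ofReal_le_ofReal hprod
    _ ≤ ENNReal.ofReal (∫ ω, X ω ∂μ) * ENNReal.ofReal (∫ ω, Y ω ∂μ) +
        ENNReal.ofReal (κ / ε ^ 2) := by
        refine ENNReal.ofReal_add_le.trans ?_
        rw [ENNReal.ofReal_mul (integral_nonneg hX0)]
    _ ≤ _ := by
        gcongr
        · exact hupper mX hX0 hX1 fun ω h => of_levelFraction_pos hC hε h
        · exact hupper mY hY0 hY1 fun ω h => of_levelFraction_pos hC' hε h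

end Decoupling
-- Cutting lattice and continuous paths at a sphere
section Curves

variable {d : ℕ}

local notation "𝔼" => EuclideanSpace ℝ (Fin d)

/-- `K` is the trace of a path in `S`. -/
def IsCurve (T : Space) (S K : Set 𝔼) : Prop :=
  match T with
  | .lattice => ∃ n γ, IsLatticePath S n γ ∧ K = pathTrace n γ
  | .continuum => ∃ (a b : 𝔼) (γ : Path a b), (∀ t, γ t ∈ S) ∧ K = range γ

lemma joinedIn_range_path {X : Type*} [TopologicalSpace X] {x y a b : X} (γ : Path x y)
    (ha : a ∈ range γ) (hb : b ∈ range γ) : JoinedIn (range γ) a b := by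
  have : PathConnectedSpace unitInterval := isPathConnected_iff_pathConnectedSpace.1
    ((convex_Icc (0 : ℝ) 1).isPathConnected ⟨0, by simp⟩)
  exact (isPathConnected_range γ.continuous).joinedIn a ha b hb

lemma connects_iff_exists_curve {T : Space} {S A B : Set 𝔼} :
    T.Connects S A B ↔ ∃ K, IsCurve T S K ∧ (K ∩ A).Nonempty ∧ (K ∩ B).Nonempty := by
  cases T with
  | lattice =>
    constructor
    · rintro ⟨n, γ, h, hA, hB⟩
      exact ⟨_, ⟨n, γ, h, rfl⟩, hA, hB⟩
    · rintro ⟨_, ⟨n, γ, h, rfl⟩, hA, hB⟩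
      exact ⟨n, γ, h, hA, hB⟩
  | continuum =>
    constructor
    · rintro ⟨a, ha, b, hb, h⟩
      exact ⟨_, ⟨a, b, h.somePath, h.somePath_mem, rfl⟩, ⟨a, ⟨0, by simp⟩, ha⟩,
        ⟨b, ⟨1, by simp⟩, hb⟩⟩
    · rintro ⟨_, ⟨_, _, γ, h, rfl⟩, ⟨a, haγ, ha⟩, ⟨b, hbγ, hb⟩⟩
      exact ⟨a, ha, b, hb, (joinedIn_range_path γ haγ hbγ).mono
        (by rintro _ ⟨t, rfl⟩; exact h t)⟩

lemma IsCurve.mono {T : Space} {S S' K : Set 𝔼} (h : IsCurve T S K) (hS : S ⊆ S') :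
    IsCurve T S' K := by
  cases T with
  | lattice =>
    obtain ⟨n, γ, h, rfl⟩ := h
    exact ⟨n, γ, ⟨fun i hi => ⟨(h.1 i hi).1, hS (h.1 i hi).2⟩, h.2⟩, rfl⟩
  | continuum =>
    obtain ⟨a, b, γ, h, rfl⟩ := h
    exact ⟨a, b, γ, fun t => hS (h t), rfl⟩

lemma Space.Connects.mono {T : Space} {S S' A A' B B' : Set 𝔼} (h : T.Connects S A B)
    (hS : S ⊆ S') (hA : A ⊆ A') (hB : B ⊆ B') : T.Connects S' A' B' := by
  rw [connects_iff_exists_curve] at *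
  obtain ⟨K, hK, h1, h2⟩ := h
  exact ⟨K, hK.mono hS, h1.mono (by gcongr), h2.mono (by gcongr)⟩

/-- The minimum makes the last vertex a degenerate edge, so that vertices and edges are handled
together, even when `n = 0`. -/
lemma mem_pathTrace_iff {n : ℕ} {γ : ℕ → 𝔼} {z : 𝔼} :
    z ∈ pathTrace n γ ↔ ∃ i ≤ n, z ∈ segment ℝ (γ i) (γ (min (i + 1) n)) := by
  constructor
  · rintro (⟨i, hi, rfl⟩ | ⟨i, hi, hz⟩)
    · exact ⟨i, hi, left_mem_segment _ _ _⟩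
    · exact ⟨i, hi.le, by rwa [min_eq_left (by omega)]⟩
  · rintro ⟨i, hi, hz⟩
    rcases hi.lt_or_eq with h | rfl
    · exact Or.inr ⟨i, h, by rwa [min_eq_left (by omega)] at hz⟩
    · rw [min_eq_right (by omega), segment_same] at hz
      exact Or.inl ⟨i, le_rfl, hz⟩

lemma exists_mem_segment_dist_eq {p w y : 𝔼} {r : ℝ} (hp : dist p y ≤ r) (hw : r ≤ dist w y) :
    ∃ z ∈ segment ℝ p w, dist z y = r := by
  obtain ⟨z, hz, h⟩ := (convex_segment (𝕜 := ℝ) p w).isPreconnected.intermediate_value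
    (left_mem_segment ℝ p w) (right_mem_segment ℝ p w)
    (f := fun z => dist z y) (by fun_prop) ⟨hp, hw⟩
  exact ⟨z, hz, h⟩

lemma dist_le_of_mem_segment {p q z : 𝔼} {t : ℝ} (hpq : dist p q ≤ t) (hz : z ∈ segment ℝ p q) :
    dist p z ≤ t ∧ dist q z ≤ t := by
  have h0 : 0 ≤ t := dist_nonneg.trans hpq
  constructor
  · have := (convex_closedBall p t).segment_subset (Metric.mem_closedBall_self h0)
      (by rwa [Metric.mem_closedBall']) hz
    rwa [Metric.mem_closedBall'] at this
  · have := (convex_closedBall q t).segment_subset (by rwa [Metric.mem_closedBall])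
      (Metric.mem_closedBall_self h0) hz
    rwa [Metric.mem_closedBall'] at this

/-- Stop after the first edge, from the `i`-th on, that reaches distance `r`. This edge meets the
sphere and has length at most one, whence the radius `r + 1`. -/
lemma IsLatticePath.exists_cut_of_le {S : Set 𝔼} {n : ℕ} {γ : ℕ → 𝔼} (h : IsLatticePath S n γ)
    {a b y : 𝔼} {r : ℝ} {i j : ℕ} (hij : i ≤ j) (hj : j ≤ n)
    (ha : a ∈ segment ℝ (γ i) (γ (min (i + 1) n))) (hb : b ∈ segment ℝ (γ j) (γ (min (j + 1) n)))
    (har : dist a y ≤ r) (hbr : r ≤ dist b y) :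
    ∃ m γ', IsLatticePath (S ∩ Metric.closedBall y (r + 1)) m γ' ∧
      pathTrace m γ' ⊆ pathTrace n γ ∧ a ∈ pathTrace m γ' ∧
      ∃ b' ∈ pathTrace m γ', dist b' y = r := by
  classical
  have hex : ∃ k, i ≤ k ∧ k ≤ n ∧ ∃ w ∈ segment ℝ (γ k) (γ (min (k + 1) n)), r ≤ dist w y :=
    ⟨j, hij, hj, b, hb, hbr⟩
  set k := Nat.find hex with hk
  obtain ⟨hik, hkn, w, hw, hwr⟩ := Nat.find_spec hex
  have hmin : ∀ l, i ≤ l → l < k → ∀ w ∈ segment ℝ (γ l) (γ (min (l + 1) n)), dist w y < r := by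
    intro l hil hlk w hw
    by_contra hcon
    exact Nat.find_min hex hlk ⟨hil, by omega, w, hw, not_lt.1 hcon⟩
  obtain ⟨p, hp, hpr⟩ : ∃ p ∈ segment ℝ (γ k) (γ (min (k + 1) n)), dist p y ≤ r := by
    rcases hik.eq_or_lt with e | hlt
    · exact ⟨a, by rw [← hk] at e; rwa [← e], har⟩
    · refine ⟨γ k, left_mem_segment _ _ _, ?_⟩
      have := hmin (k - 1) (by omega) (by omega) (γ (min (k - 1 + 1) n)) (right_mem_segment _ _ _)
      rw [show min (k - 1 + 1) n = k by omega] at this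
      exact this.le
  obtain ⟨b', hb', hb'r⟩ := exists_mem_segment_dist_eq hpr hwr
  have hb'k := (convex_segment _ _).segment_subset hp hw hb'
  have hlen : dist (γ k) (γ (min (k + 1) n)) ≤ 1 := by
    rcases hkn.lt_or_eq with hlt | e
    · rw [min_eq_left (by omega)]
      exact (h.2 k hlt).le
    · rw [min_eq_right (by omega), show n = k from e.symm, dist_self]
      exact zero_le_one
  obtain ⟨hd1, hd2⟩ := dist_le_of_mem_segment hlen hb'k
  have hseg : ∀ l, i + l ≤ k → min (i + l + 1) n = i + min (l + 1) (min (k + 1) n - i) := by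
    intro l hl; omega
  refine ⟨min (k + 1) n - i, fun l => γ (i + l), ⟨fun l hl => ?_, fun l hl => ?_⟩, ?_, ?_, b', ?_,
    hb'r⟩
  · refine ⟨(h.1 _ (by omega)).1, (h.1 _ (by omega)).2, ?_⟩
    change dist (γ (i + l)) y ≤ r + 1
    rcases lt_trichotomy (i + l) k with hlt | heq | hgt
    · have := hmin (i + l) (by omega) hlt _ (left_mem_segment _ _ _)
      linarith
    · rw [heq]
      linarith [dist_triangle (γ k) b' y]
    · rw [show i + l = min (k + 1) n by omega]
      linarith [dist_triangle (γ (min (k + 1) n)) b' y]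
  · exact h.2 (i + l) (by omega)
  · intro z hz
    obtain ⟨l, hl, hz⟩ := mem_pathTrace_iff.1 hz
    rcases le_or_gt (i + l) k with hlk | hlk
    · rw [← hseg l hlk] at hz
      exact mem_pathTrace_iff.2 ⟨i + l, by omega, hz⟩
    · rw [show min (l + 1) (min (k + 1) n - i) = l by omega, segment_same] at hz
      exact Or.inl ⟨i + l, by omega, hz⟩
  · refine mem_pathTrace_iff.2 ⟨0, by omega, ?_⟩
    rw [← hseg 0 (by omega)]
    exact ha
  · refine mem_pathTrace_iff.2 ⟨k - i, by omega, ?_⟩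
    rw [← hseg (k - i) (by omega), show i + (k - i) = k by omega]
    exact hb'k

lemma IsLatticePath.reverse {S : Set 𝔼} {n : ℕ} {γ : ℕ → 𝔼} (h : IsLatticePath S n γ) :
    IsLatticePath S n fun i => γ (n - i) := by
  refine ⟨fun i _ => h.1 _ (by omega), fun i hi => ?_⟩
  have := h.2 (n - (i + 1)) (by omega)
  rwa [show n - (i + 1) + 1 = n - i by omega, dist_comm] at this

lemma pathTrace_reverse_subset {n : ℕ} {γ : ℕ → 𝔼} :
    pathTrace n (fun i => γ (n - i)) ⊆ pathTrace n γ := by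
  rintro z (⟨i, hi, rfl⟩ | ⟨i, hi, hz⟩)
  · exact Or.inl ⟨n - i, by omega, rfl⟩
  · refine Or.inr ⟨n - (i + 1), by omega, ?_⟩
    rwa [show n - (i + 1) + 1 = n - i by omega, segment_symm]

/-- A curve from inside a ball to outside the ball contains a curve that stays in a slightly larger
ball and ends on the boundary of the ball. -/
lemma IsCurve.exists_cut {T : Space} {S K : Set 𝔼} (h : IsCurve T S K) {a b y : 𝔼} {r : ℝ}
    (ha : a ∈ K) (hb : b ∈ K) (har : dist a y ≤ r) (hbr : r ≤ dist b y) :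
    ∃ K', IsCurve T (S ∩ Metric.closedBall y (r + 1)) K' ∧ K' ⊆ K ∧ a ∈ K' ∧
      ∃ b' ∈ K', dist b' y = r := by
  cases T with
  | lattice =>
    obtain ⟨n, γ, h, rfl⟩ := h
    obtain ⟨i, hi, hai⟩ := mem_pathTrace_iff.1 ha
    obtain ⟨j, hj, hbj⟩ := mem_pathTrace_iff.1 hb
    rcases le_or_gt i j with hij | hij
    · obtain ⟨m, γ', h1, h2, h3, h4⟩ := h.exists_cut_of_le hij hj hai hbj har hbr
      exact ⟨_, ⟨m, γ', h1, rfl⟩, h2, h3, h4⟩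
    · have hbj' : b ∈ segment ℝ (γ (n - (n - (j + 1)))) (γ (n - min (n - (j + 1) + 1) n)) := by
        rw [segment_symm, show n - (n - (j + 1)) = min (j + 1) n by omega,
          show n - min (n - (j + 1) + 1) n = j by omega]
        exact hbj
      -- If `i = n`, truncated subtraction gives edge `0` of the reversed path, which starts at `a`.
      have hai' : a ∈ segment ℝ (γ (n - (n - (i + 1)))) (γ (n - min (n - (i + 1) + 1) n)) := by
        rcases hi.lt_or_eq with hlt | rfl
        · rw [segment_symm, show n - (n - (i + 1)) = min (i + 1) n by omega,
            show n - min (n - (i + 1) + 1) n = i by omega]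
          exact hai
        · rw [min_eq_right (by omega), segment_same] at hai
          rw [show i - (i - (i + 1)) = i by omega, show a = γ i from hai]
          exact left_mem_segment _ _ _
      obtain ⟨m, γ', h1, h2, h3, h4⟩ := h.reverse.exists_cut_of_le
        (i := n - (i + 1)) (j := n - (j + 1)) (by omega) (by omega) hai' hbj' har hbr
      exact ⟨_, ⟨m, γ', h1, rfl⟩, h2.trans pathTrace_reverse_subset, h3, h4⟩
  | continuum =>
    obtain ⟨_, _, γ, hS, rfl⟩ := h
    have hj := joinedIn_range_path γ ha hb
    set g := hj.somePath with hg
    have hgK := hj.somePath_mem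
    have hcont : Continuous fun t => dist (g t) y := by fun_prop
    have hcomp : IsCompact {t | r ≤ dist (g t) y} :=
      (isClosed_le continuous_const hcont).isCompact
    -- The continuous analogue: stop at the first time at distance at least `r`.
    obtain ⟨t₀, ht₀, hleast⟩ := hcomp.exists_isLeast ⟨1, by simpa using hbr⟩
    have hlt : ∀ t, t < t₀ → dist (g t) y < r := fun t ht => by
      by_contra hcon
      exact absurd (hleast (not_lt.1 hcon)) (not_le.2 ht)
    have heq : dist (g t₀) y = r := by
      obtain ⟨t, ht, h⟩ := intermediate_value_Icc (a := 0) (b := t₀) t₀.2.1 hcont.continuousOn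
        (⟨by simpa using har, ht₀⟩ : r ∈ Icc _ _)
      have : t = t₀ := le_antisymm ht.2 (hleast (show r ≤ _ from h.ge))
      rw [← this]; exact h
    let g' : Path a (g t₀) :=
      { toFun := fun s => g (s * t₀)
        continuous_toFun := by fun_prop
        source' := by simp
        target' := by simp }
    refine ⟨range g', ⟨a, g t₀, g', fun s => ⟨?_, ?_⟩, rfl⟩, ?_, ⟨0, by simp⟩, g t₀,
      ⟨1, by simp⟩, heq⟩
    · obtain ⟨t, ht⟩ := hgK (s * t₀)
      change g (s * t₀) ∈ S
      rw [hg, ← ht]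
      exact hS t
    · rw [Metric.mem_closedBall]
      change dist (g (s * t₀)) y ≤ r + 1
      rcases (unitInterval.mul_le_right : s * t₀ ≤ t₀).lt_or_eq with hlt' | e
      · linarith [hlt _ hlt']
      · rw [e]; linarith
    · rintro _ ⟨s, rfl⟩
      exact hgK (s * t₀)

end Curves
-- Decoupling of finitely many events
section Events

variable {ι Ω : Type*} [PseudoMetricSpace ι] [MeasurableSpace Ω] {μ : Measure Ω} {f : ι → Ω → ℝ}

/-- Sprinkled decoupling of finitely many increasing events. -/
lemma measure_forall_le_pow (hf : IsGaussianProcess f μ)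
    (hcont : ∀ᵐ ω ∂μ, Continuous fun x => f x ω) {I : Type*} {D : I → Set ι}
    (hD : ∀ i, IsCompact (D i)) {C : I → (ι → ℝ) → Prop} (hC : ∀ i, IncreasingOn (D i) (C i))
    {κ : ℝ} (hκ0 : 0 ≤ κ)
    (hκ : ∀ i j, i ≠ j → ∀ x ∈ D i, ∀ y ∈ D j, |cov[f x, f y; μ]| ≤ κ) {ε L : ℝ} (hε : 0 < ε)
    {P : ℝ≥0∞} (hP1 : P ≤ 1) (hP : ∀ i, μ {ω | C i fun x => f x ω + L} ≤ P) (s : Finset I) :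
    ∀ ℓ : ℝ, ℓ + s.card * ε ≤ L → μ {ω | ∀ i ∈ s, C i fun x => f x ω + ℓ} ≤
      P ^ s.card + s.card * ENNReal.ofReal (κ / ε ^ 2) := by
  classical
  have := hf.isProbabilityMeasure
  induction s using Finset.induction_on with
  | empty => intro ℓ _; simp
  | insert i s hi ih =>
    intro ℓ hℓ
    rw [Finset.card_insert_of_notMem hi] at hℓ ⊢
    push_cast at hℓ
    have h := sprinkled_decoupling hf hcont (s.isCompact_biUnion fun j _ => hD j) (hD i) hκ0
      (fun x hx y hy => by
        obtain ⟨j, hj, hx⟩ := mem_iUnion₂.1 hx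
        exact hκ j i (fun e => hi (e ▸ hj)) x hx y hy)
      ((IncreasingOn.forall_mem hC s).add_const ℓ) ((hC i).add_const ℓ) hε
    have hs0 : (0 : ℝ) ≤ s.card * ε := by positivity
    have h1 : μ {ω | ∀ j ∈ s, C j fun x => f x ω + ε + ℓ} ≤
        P ^ s.card + s.card * ENNReal.ofReal (κ / ε ^ 2) := by
      have := ih (ε + ℓ) (by linarith)
      simpa only [← add_assoc] using this
    have h2 : μ {ω | C i fun x => f x ω + ε + ℓ} ≤ P :=
      (measure_mono fun ω hω => hC i _ _ (fun x _ => by linarith) hω).trans (hP i)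
    calc μ {ω | ∀ j ∈ insert i s, C j fun x => f x ω + ℓ}
        ≤ μ {ω | (∀ j ∈ s, C j fun x => f x ω + ℓ) ∧ C i fun x => f x ω + ℓ} :=
          measure_mono fun ω hω => ⟨fun j hj => hω j (Finset.mem_insert_of_mem hj),
            hω i (Finset.mem_insert_self i s)⟩
      _ ≤ _ := h
      _ ≤ (P ^ s.card + s.card * ENNReal.ofReal (κ / ε ^ 2)) * P + ENNReal.ofReal (κ / ε ^ 2) := by
          gcongr
      _ = P ^ (s.card + 1) + (s.card * ENNReal.ofReal (κ / ε ^ 2) * P +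
          1 * ENNReal.ofReal (κ / ε ^ 2)) := by ring
      _ ≤ P ^ (s.card + 1) + (s.card * ENNReal.ofReal (κ / ε ^ 2) * 1 +
          1 * ENNReal.ofReal (κ / ε ^ 2)) := by gcongr
      _ = _ := by push_cast; ring

end Events

/-! ### Renormalization of annulus crossings -/

section Annuli

variable {d : ℕ}

local notation "𝔼" => EuclideanSpace ℝ (Fin d)

lemma isClosed_pts (T : Space) : IsClosed (T.pts d) := by
  cases T with
  | continuum => exact isClosed_univ
  | lattice =>
    have : Space.lattice.pts d = ⋂ i, (fun x : 𝔼 => x i) ⁻¹' (range ((↑) : ℤ → ℝ)) := by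
      ext x
      simp [Space.pts, eq_comm]
    rw [this]
    exact isClosed_iInter fun i =>
      (Int.isClosedEmbedding_coe_real.isClosed_range).preimage (by fun_prop)

lemma isCompact_pts_ball (T : Space) (y : 𝔼) (r : ℝ) :
    IsCompact {x : T.pts d | (x : 𝔼) ∈ Metric.closedBall y r} :=
  (isClosed_pts T).isClosedEmbedding_subtypeVal.isCompact_preimage (isCompact_closedBall y r)

lemma excursion_mono {T : Space} {u v : T.pts d → ℝ} {ℓ ℓ' : ℝ} {A : Set 𝔼}
    (h : ∀ x : T.pts d, (x : 𝔼) ∈ A → u x + ℓ ≤ v x + ℓ') :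
    excursion T u ℓ ∩ A ⊆ excursion T v ℓ' ∩ A := by
  rintro x ⟨⟨hx, hu⟩, hA⟩
  exact ⟨⟨hx, hu.trans (h _ hA)⟩, hA⟩

lemma excursion_add {T : Space} (u : T.pts d → ℝ) (ℓ : ℝ) :
    excursion T (fun x => u x + ℓ) 0 = excursion T u ℓ := by
  simp [excursion]

/-- There is a path in `{u ≥ 0}` which crosses the annulus around `y` of radii `r` and `2 * r` and
does not go far outside it. -/
def CrossesAnnulus (T : Space) (y : 𝔼) (r : ℝ) (u : T.pts d → ℝ) : Prop :=
  T.Connects (excursion T u 0 ∩ Metric.closedBall y (2 * r + 1)) (Metric.closedBall y r)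
    (Metric.sphere y (2 * r))

lemma increasingOn_crossesAnnulus (T : Space) (y : 𝔼) (r : ℝ) :
    IncreasingOn {x : T.pts d | (x : 𝔼) ∈ Metric.closedBall y (2 * r + 1)}
      (CrossesAnnulus T y r) :=
  fun u v huv h => h.mono (excursion_mono fun x hx => by linarith [huv x hx]) Subset.rfl Subset.rfl

variable {T : Space} {Ω : Type*} [MeasurableSpace Ω] {μ : Measure Ω} {f : T.pts d → Ω → ℝ}

lemma connProb_mono {ℓ ℓ' : ℝ} (h : ℓ ≤ ℓ') {A A' B B' : Set 𝔼} (hA : A ⊆ A') (hB : B ⊆ B') :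
    connProb T μ f ℓ A B ≤ connProb T μ f ℓ' A' B' := by
  refine measure_mono fun ω hω => Space.Connects.mono hω ?_ hA hB
  rintro x ⟨hx, hu⟩
  exact ⟨hx, by linarith⟩

lemma measure_crossesAnnulus_le (ℓ : ℝ) (y : 𝔼) (r : ℝ) :
    μ {ω | CrossesAnnulus T y r fun x => f x ω + ℓ} ≤
      connProb T μ f ℓ (Metric.closedBall y r) (Metric.sphere y (2 * r)) := by
  refine measure_mono fun ω hω => ?_
  have h : T.Connects _ _ _ := hω
  rw [excursion_add] at h
  exact h.mono inter_subset_left Subset.rfl Subset.rfl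

/-- By scaling, one net of a fixed ball serves all centres and scales; its size is the entropy
constant of the renormalization. -/
lemma exists_finite_net (W : ℝ) {η : ℝ} (hη : 0 < η) :
    ∃ t : Finset 𝔼, ∀ (x : 𝔼) (r : ℝ), 0 < r → ∀ z, dist z x ≤ W * r →
      ∃ τ ∈ t, dist z (x + r • τ) ≤ η * r := by
  obtain ⟨t, -, htf, ht⟩ := (isCompact_closedBall (0 : 𝔼) W).finite_cover_balls hη
  refine ⟨htf.toFinset, fun x r hr z hz => ?_⟩
  have hz' : r⁻¹ • (z - x) ∈ Metric.closedBall (0 : 𝔼) W := by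
    rw [mem_closedBall_zero_iff, norm_smul, norm_inv, Real.norm_of_nonneg hr.le,
      inv_mul_le_iff₀ hr, ← dist_eq_norm, mul_comm]
    exact hz
  obtain ⟨τ, hτ, h⟩ := mem_iUnion₂.1 (ht hz')
  refine ⟨τ, by simpa using hτ, ?_⟩
  have e : z - (x + r • τ) = r • (r⁻¹ • (z - x) - τ) := by
    rw [smul_sub, smul_inv_smul₀ hr.ne']
    abel
  rw [dist_eq_norm, e, norm_smul, Real.norm_of_nonneg hr.le, mul_comm, ← dist_eq_norm]
  exact mul_le_mul_of_nonneg_right (Metric.mem_ball.1 h).le hr.le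

lemma IsCurve.crossesAnnulus {u : T.pts d → ℝ} {K : Set 𝔼} (hK : IsCurve T (excursion T u 0) K)
    {z b y : 𝔼} {r : ℝ} (hz : z ∈ K) (hb : b ∈ K) (hr : 0 ≤ r) (hzr : dist z y ≤ r)
    (hbr : 2 * r ≤ dist b y) : CrossesAnnulus T y r u := by
  obtain ⟨K', hK', -, hzK', b', hb', hb'r⟩ := hK.exists_cut (r := 2 * r) hz hb (by linarith) hbr
  exact connects_iff_exists_curve.2 ⟨K', hK', ⟨z, hzK', hzr⟩, ⟨b', hb', hb'r⟩⟩

/-- A long connection crosses five well-separated annuli. -/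
lemma exists_five_annuli {t : Finset 𝔼} (ht : ∀ (x : 𝔼) (r : ℝ), 0 < r → ∀ z, dist z x ≤ 50 * r →
      ∃ τ ∈ t, dist z (x + r • τ) ≤ 1 / 10 * r)
    {u : T.pts d → ℝ} {x : 𝔼} {r s : ℝ} (hr : 0 < r) (hs : s ≤ 25 * r)
    (h : T.Connects (excursion T u 0) (Metric.closedBall x s) (Metric.sphere x (s + 25 * r))) :
    ∃ q : Fin 5 → t, ∀ i : Fin 5,
      |dist (x + r • (q i : 𝔼)) x - (s + 5.5 * (i : ℕ) * r)| ≤ 1 / 10 * r ∧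
      CrossesAnnulus T (x + r • (q i : 𝔼)) r u := by
  obtain ⟨K, hK, ⟨a, ha, has⟩, ⟨b, hb, hbs⟩⟩ := connects_iff_exists_curve.1 h
  rw [Metric.mem_closedBall] at has
  rw [Metric.mem_sphere] at hbs
  have hi : ∀ i : Fin 5, ∃ τ : t,
      |dist (x + r • (τ : 𝔼)) x - (s + 5.5 * (i : ℕ) * r)| ≤ 1 / 10 * r ∧
      CrossesAnnulus T (x + r • (τ : 𝔼)) r u := fun i => by
    have hi4 : ((i : ℕ) : ℝ) ≤ 4 := by exact_mod_cast Nat.le_of_lt_succ i.2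
    have hi0 : (0 : ℝ) ≤ ((i : ℕ) : ℝ) * r := by positivity
    have hi4' : ((i : ℕ) : ℝ) * r ≤ 4 * r := by gcongr
    -- The curve meets each sphere of radius `s + 5.5 i r`. The largest radius is `s + 22 r`, so the
    -- endpoint `b` stays at distance at least `2.9 r` from every chosen centre, more than the `2 r`
    -- needed.
    obtain ⟨_, -, hsub, -, z, hz, hzx⟩ := hK.exists_cut (y := x) (r := s + 5.5 * (i : ℕ) * r) ha hb
      (by linarith) (by linarith)
    obtain ⟨τ, hτ, hzτ⟩ := ht x r hr z (by linarith)
    refine ⟨⟨τ, hτ⟩, ?_, hK.crossesAnnulus (hsub hz) hb hr.le (by linarith) ?_⟩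
    · rw [← hzx]
      refine (abs_dist_sub_le _ _ _).trans ?_
      rwa [dist_comm]
    · have h1 := dist_triangle b (x + r • τ) x
      have h2 := dist_triangle (x + r • τ) z x
      rw [dist_comm _ z] at h2
      linarith
  choose q hq using hi
  exact ⟨q, hq⟩

/-- The renormalization inequality. -/
lemma exists_connProb_le_pow (d : ℕ) : ∃ N : ℕ, ∀ {T : Space} {Ω : Type*} [MeasurableSpace Ω]
    {μ : Measure Ω} {f : T.pts d → Ω → ℝ}, IsGaussianProcess f μ →
    (∀ᵐ ω ∂μ, Continuous fun x => f x ω) → ∀ {r s κ ε ℓ : ℝ}, 7 ≤ r → s ≤ 25 * r →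
    0 ≤ κ → (∀ x y : T.pts d, r ≤ dist x y → |cov[f x, f y; μ]| ≤ κ) → 0 < ε →
    ∀ {P : ℝ≥0∞}, P ≤ 1 → (∀ y, connProb T μ f (ℓ + 5 * ε) (Metric.closedBall y r)
      (Metric.sphere y (2 * r)) ≤ P) → ∀ x, connProb T μ f ℓ (Metric.closedBall x s)
      (Metric.sphere x (s + 25 * r)) ≤ N * (P ^ 5 + 5 * ENNReal.ofReal (κ / ε ^ 2)) := by
  obtain ⟨t, ht⟩ := exists_finite_net (d := d) 50 (show (0 : ℝ) < 1 / 10 by norm_num)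
  refine ⟨Fintype.card (Fin 5 → t), ?_⟩
  intro T Ω _ μ f hf hcont r s κ ε ℓ hr hs hκ0 hκ hε P hP1 hP x
  let Adm : (Fin 5 → t) → Prop := fun q => ∀ i : Fin 5,
    |dist (x + r • (q i : EuclideanSpace ℝ (Fin d))) x - (s + 5.5 * (i : ℕ) * r)| ≤ 1 / 10 * r
  let A : (Fin 5 → t) → Set Ω := fun q => {ω | Adm q ∧ ∀ i : Fin 5,
    CrossesAnnulus T (x + r • (q i : EuclideanSpace ℝ (Fin d))) r fun x => f x ω + ℓ}
  have hsub : {ω | T.Connects (excursion T (fun x => f x ω) ℓ) (Metric.closedBall x s)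
      (Metric.sphere x (s + 25 * r))} ⊆ ⋃ q, A q := by
    intro ω hω
    have hω' : T.Connects _ _ _ := hω
    rw [← excursion_add] at hω'
    obtain ⟨q, hq⟩ := exists_five_annuli ht (by linarith) hs hω'
    exact mem_iUnion.2 ⟨q, fun i => (hq i).1, fun i => (hq i).2⟩
  have hA : ∀ q, μ (A q) ≤ P ^ 5 + 5 * ENNReal.ofReal (κ / ε ^ 2) := by
    intro q
    by_cases hq : Adm q
    · have key := measure_forall_le_pow hf hcont (I := Fin 5)
        (D := fun i => {z : T.pts d | (z : EuclideanSpace ℝ (Fin d)) ∈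
          Metric.closedBall (x + r • (q i : EuclideanSpace ℝ (Fin d))) (2 * r + 1)})
        (fun i => isCompact_pts_ball T _ _) (fun i => increasingOn_crossesAnnulus T _ r) hκ0
        (L := ℓ + 5 * ε) (ε := ε) (fun i j hij y hy z hz => hκ y z ?_) hε hP1
        (fun i => (measure_crossesAnnulus_le _ _ _).trans (hP _)) Finset.univ ℓ
        (by simp)
      · refine (measure_mono fun ω hω => ?_).trans (by simpa using key)
        exact fun i => hω.2 i
      -- Distinct centres are at distance at least `5.3 r`, and the events live in balls of radius
      -- `2 r + 1`. The regions are therefore at distance at least `1.3 r - 2`, which is at least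
      -- `r` since `r ≥ 7`.
      · have hi := abs_le.1 (hq i)
        have hj := abs_le.1 (hq j)
        have hy' : dist (y : EuclideanSpace ℝ (Fin d)) _ ≤ _ := hy
        have hz' : dist (z : EuclideanSpace ℝ (Fin d)) _ ≤ _ := hz
        set yi := x + r • (q i : EuclideanSpace ℝ (Fin d))
        set yj := x + r • (q j : EuclideanSpace ℝ (Fin d))
        have t1 := dist_triangle yi y yj
        have t2 := dist_triangle (y : EuclideanSpace ℝ (Fin d)) z yj
        have t3 := dist_triangle yi yj x
        have t4 := dist_triangle yj yi x
        rw [dist_comm yi y] at t1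
        rw [dist_comm yj yi] at t4
        rw [Subtype.dist_eq]
        rcases lt_or_gt_of_ne hij with h | h
        · have : ((i : ℕ) : ℝ) + 1 ≤ (j : ℕ) := by exact_mod_cast Fin.lt_def.1 h
          nlinarith
        · have : ((j : ℕ) : ℝ) + 1 ≤ (i : ℕ) := by exact_mod_cast Fin.lt_def.1 h
          nlinarith
    · have : A q = ∅ := by ext ω; simp [A, hq]
      simp [this]
  calc _ ≤ μ (⋃ q, A q) := measure_mono hsub
    _ ≤ ∑ q, μ (A q) := measure_iUnion_fintype_le _ _
    _ ≤ ∑ _q : Fin 5 → t, (P ^ 5 + 5 * ENNReal.ofReal (κ / ε ^ 2)) :=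
        Finset.sum_le_sum fun q _ => hA q
    _ = _ := by rw [Finset.sum_const, Finset.card_univ, nsmul_eq_mul]

/-- Crossing a large annulus forces the crossing of one of boundedly many smaller ones. -/
lemma exists_connProb_le_mul (d : ℕ) : ∃ N : ℕ, ∀ {T : Space} {Ω : Type*} [MeasurableSpace Ω]
    {μ : Measure Ω} {f : T.pts d → Ω → ℝ} {r ρ ℓ : ℝ}, 0 < r → 3 * r ≤ ρ → ρ ≤ 75 * r →
    ∀ {P : ℝ≥0∞}, (∀ y, connProb T μ f ℓ (Metric.closedBall y r) (Metric.sphere y (2 * r)) ≤ P) →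
    ∀ x, connProb T μ f ℓ (Metric.closedBall x ρ) (Metric.sphere x (2 * ρ)) ≤ N * P := by
  obtain ⟨t, ht⟩ := exists_finite_net (d := d) 75 zero_lt_one
  refine ⟨t.card, ?_⟩
  intro T Ω _ μ f r ρ ℓ hr hρ hρ' P hP x
  have hsub : {ω | T.Connects (excursion T (fun x => f x ω) ℓ) (Metric.closedBall x ρ)
      (Metric.sphere x (2 * ρ))} ⊆
      ⋃ τ ∈ t, {ω | CrossesAnnulus T (x + r • τ) r fun x => f x ω + ℓ} := by
    intro ω hω
    have hω' : T.Connects _ _ _ := hω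
    rw [← excursion_add] at hω'
    obtain ⟨K, hK, ⟨a, ha, hax⟩, ⟨b, hb, hbx⟩⟩ := connects_iff_exists_curve.1 hω'
    rw [Metric.mem_closedBall] at hax
    rw [Metric.mem_sphere] at hbx
    obtain ⟨τ, hτ, haτ⟩ := ht x r hr a (by linarith)
    refine mem_biUnion hτ (hK.crossesAnnulus ha hb hr.le (by linarith) ?_)
    have h1 := dist_triangle b (x + r • τ) x
    have h2 := dist_triangle (x + r • τ) a x
    rw [dist_comm _ a] at h2
    linarith
  calc _ ≤ _ := measure_mono hsub
    _ ≤ ∑ τ ∈ t, μ {ω | CrossesAnnulus T (x + r • τ) r fun x => f x ω + ℓ} :=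
        measure_biUnion_finset_le _ _
    _ ≤ ∑ _τ ∈ t, P := Finset.sum_le_sum fun τ _ => (measure_crossesAnnulus_le _ _ _).trans (hP _)
    _ = _ := by rw [Finset.sum_const, nsmul_eq_mul]

end Annuli
-- The multiscale recursion
section Recursion

/-- A sequence which contracts faster than `w` up to an error of order `w` is eventually of order
`w`; the number of steps only depends on a lower bound `v` for `w 0`. -/
lemma exists_forall_le_mul_of_pow_five {A B K v : ℝ} (hB : 0 ≤ B) (hA : 1 ≤ A)
    (hK : K = A * (1 + B)) (hv : 0 < v) :
    ∃ n₀ : ℕ, ∀ q w : ℕ → ℝ, (∀ n, 0 ≤ q n) → (∀ n, 0 < w n) → v ≤ w 0 →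
      (∀ n, K ^ 5 * w n ≤ 1) → (∀ n, w n ^ 4 ≤ w (n + 1)) → q 0 ≤ 1 / (2 * K) →
      (∀ n, q (n + 1) ≤ A * (q n ^ 5 + B * w (n + 1))) → ∀ n ≥ n₀, q n ≤ K * w n := by
  have hK1 : 1 ≤ K := by rw [hK]; nlinarith
  obtain ⟨j, hj⟩ := exists_pow_lt_of_lt_one hv (show (1 / 2 : ℝ) < 1 by norm_num)
  obtain ⟨n₀, hn₀⟩ := pow_unbounded_of_one_lt (j : ℝ) (show (1 : ℝ) < 5 / 4 by norm_num)
  refine ⟨n₀, fun q w hq hw hvw hwK hw4 hq0 hrec => ?_⟩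
  -- The first alternative persists once reached. Until then `q n ^ 5` dominates the error, so `K *
  -- q n` is at most its fifth power at the next step. Since `w n ≥ v ^ 4 ^ n`, the second
  -- alternative implies the first for large `n`.
  have key : ∀ n, q n ≤ K * w n ∨ K * q n ≤ (1 / 2) ^ 5 ^ n := by
    intro n
    induction n with
    | zero =>
      right
      have : K * q 0 ≤ K * (1 / (2 * K)) := by gcongr
      refine this.trans (le_of_eq ?_)
      rw [pow_zero, pow_one]
      field_simp
    | succ n ih =>
      have hr := hrec n
      rcases ih with h | h
      · left
        have h5 : q n ^ 5 ≤ w (n + 1) := by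
          calc q n ^ 5 ≤ (K * w n) ^ 5 := by gcongr; exact hq n
            _ = K ^ 5 * w n * w n ^ 4 := by ring
            _ ≤ 1 * w (n + 1) := by
              gcongr
              · exact hwK n
              · exact hw4 n
            _ = w (n + 1) := one_mul _
        calc q (n + 1) ≤ A * (w (n + 1) + B * w (n + 1)) := hr.trans (by gcongr)
          _ = K * w (n + 1) := by rw [hK]; ring
      · rcases le_or_gt (q n ^ 5) (w (n + 1)) with h5 | h5
        · left
          calc q (n + 1) ≤ A * (w (n + 1) + B * w (n + 1)) := hr.trans (by gcongr)
            _ = K * w (n + 1) := by rw [hK]; ring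
        · right
          have hq5 : 0 ≤ q n ^ 5 := pow_nonneg (hq n) 5
          calc K * q (n + 1) ≤ K * (A * (q n ^ 5 + B * q n ^ 5)) := by
                gcongr
                exact hr.trans (by gcongr)
            _ = K ^ 2 * q n ^ 5 := by rw [hK]; ring
            _ ≤ K ^ 5 * q n ^ 5 := by
              gcongr 1
              exact pow_le_pow_right₀ hK1 (by norm_num)
            _ = (K * q n) ^ 5 := by ring
            _ ≤ ((1 / 2) ^ 5 ^ n) ^ 5 := by
              gcongr
              exact mul_nonneg (by linarith) (hq n)
            _ = (1 / 2) ^ 5 ^ (n + 1) := by rw [← pow_mul, pow_succ]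
  have hlow : ∀ n, v ^ 4 ^ n ≤ w n := by
    intro n
    induction n with
    | zero => simpa using hvw
    | succ n ih =>
      calc v ^ 4 ^ (n + 1) = (v ^ 4 ^ n) ^ 4 := by rw [← pow_mul, pow_succ]
        _ ≤ w n ^ 4 := by gcongr
        _ ≤ w (n + 1) := hw4 n
  intro n hn
  rcases key n with h | h
  · exact h
  · have hjn : j * 4 ^ n ≤ 5 ^ n := by
      have h1 : (j : ℝ) ≤ (5 / 4) ^ n := hn₀.le.trans (pow_le_pow_right₀ (by norm_num) hn)
      rw [div_pow, le_div_iff₀ (by positivity)] at h1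
      exact_mod_cast h1
    have h2 : K * q n ≤ w n := by
      calc K * q n ≤ (1 / 2) ^ 5 ^ n := h
        _ ≤ (1 / 2) ^ (j * 4 ^ n) := pow_le_pow_of_le_one (by norm_num) (by norm_num) hjn
        _ = ((1 / 2) ^ j) ^ 4 ^ n := by rw [pow_mul]
        _ ≤ v ^ 4 ^ n := by gcongr
        _ ≤ w n := hlow n
    have h3 := hq n
    have h4 := hw n
    nlinarith

/-- Every positive amount of sprinkling can be split into levels that decay polynomially. -/
lemma exists_sprinkling {δ Δ : ℝ} (hδ : 0 < δ) (hΔ : 0 < Δ) :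
    ∃ c > 0, ∀ n : ℕ, ∑ k ∈ Finset.range n, 5 * (c * ((k : ℝ) + 1) ^ (-(1 + δ / 2))) ≤ Δ := by
  have hsum : Summable fun k : ℕ => ((k : ℝ) + 1) ^ (-(1 + δ / 2)) := by
    have := (summable_nat_add_iff 1).2
      (Real.summable_nat_rpow (p := -(1 + δ / 2)) |>.2 (by linarith))
    simpa using this
  set σ := ∑' k : ℕ, ((k : ℝ) + 1) ^ (-(1 + δ / 2)) with hσ
  have hσ0 : 0 ≤ σ := tsum_nonneg fun k => by positivity
  refine ⟨Δ / (5 * (σ + 1)), by positivity, fun n => ?_⟩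
  rw [← Finset.mul_sum, ← Finset.mul_sum]
  have h1 : ∑ k ∈ Finset.range n, ((k : ℝ) + 1) ^ (-(1 + δ / 2)) ≤ σ + 1 :=
    (hsum.sum_le_tsum _ fun k _ => by positivity).trans (by linarith)
  calc _ ≤ 5 * (Δ / (5 * (σ + 1)) * (σ + 1)) := by gcongr
    _ = Δ := by field_simp

variable {p : ℝ → ℝ → ℝ} {g h h' : ℝ → ℝ} {δ A : ℝ}

lemma tendsto_rate_zero (hh0 : ∀ r, 0 < r → 0 < h' r) (hh' : AntitoneOn h' (Ioi 0))
    (hsq : Tendsto (fun r => h' r ^ 2 / h' (5 * r)) atTop (𝓝 0)) : Tendsto h' atTop (𝓝 0) := by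
  refine tendsto_of_tendsto_of_tendsto_of_le_of_le' tendsto_const_nhds hsq ?_ ?_
  · filter_upwards [eventually_gt_atTop 0] with r hr using (hh0 r hr).le
  · filter_upwards [eventually_gt_atTop 0] with r hr
    have h5 : 0 < h' (5 * r) := hh0 _ (by linarith)
    have := hh' (show r ∈ Ioi 0 from hr) (show 5 * r ∈ Ioi (0 : ℝ) from by simpa using hr)
      (by linarith)
    rw [le_div_iff₀ h5, sq]
    exact mul_le_mul_of_nonneg_left this (hh0 r hr).le

/-- Two steps of ratio `5` make one of ratio `25`. The exponent `4` is why five annuli are used. -/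
lemma eventually_pow_four_le (hh0 : ∀ r, 0 < r → 0 < h' r)
    (hsq : Tendsto (fun r => h' r ^ 2 / h' (5 * r)) atTop (𝓝 0)) :
    ∀ᶠ r in atTop, h' r ^ 4 ≤ h' (25 * r) := by
  have h1 : ∀ᶠ r in atTop, h' r ^ 2 ≤ h' (5 * r) := by
    filter_upwards [hsq.eventually (gt_mem_nhds zero_lt_one), eventually_gt_atTop 0] with r hr h0
    rw [div_lt_one (hh0 _ (by linarith))] at hr
    exact hr.le
  have h5 : Tendsto (fun r : ℝ => 5 * r) atTop atTop := tendsto_id.const_mul_atTop (by norm_num)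
  filter_upwards [h1, h5.eventually h1] with r ha hb
  calc h' r ^ 4 = (h' r ^ 2) ^ 2 := by ring
    _ ≤ h' (5 * r) ^ 2 := by gcongr
    _ ≤ h' (5 * (5 * r)) := hb
    _ = h' (25 * r) := by ring_nf

lemma exists_covariance_rate_bound (hdef : ∀ r, h r = g r * Real.log r ^ (2 + δ))
    (hh0 : ∀ r, 0 < r → 0 < h' r)
    (hbdd : ∃ C : ℝ, ∀ᶠ r in atTop, h r / h' (25 * r) ≤ C) :
    ∃ C, 0 ≤ C ∧ ∀ᶠ r in atTop, g r * Real.log r ^ (2 + δ) ≤ C * h' (25 * r) := by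
  obtain ⟨C, hC⟩ := hbdd
  refine ⟨max C 0, le_max_right _ _, ?_⟩
  filter_upwards [hC, eventually_gt_atTop 0] with r hr h0
  have h25 := hh0 (25 * r) (by linarith)
  rw [div_le_iff₀ h25, hdef] at hr
  exact hr.trans (mul_le_mul_of_nonneg_right (le_max_left _ _) h25.le)

/-- If crossing probabilities satisfy the renormalization inequality and are small at one large
scale, then after sprinkling they decay at rate `h'`. -/
theorem exists_forall_le_rate (hδ : 0 < δ) (hA : 1 ≤ A) (hp0 : ∀ ℓ r, 0 ≤ p ℓ r)
    (hmono : ∀ {ℓ ℓ'} r, ℓ ≤ ℓ' → p ℓ r ≤ p ℓ' r)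
    (hrec : ∀ {r ε} ℓ, 7 ≤ r → 0 < ε →
      p ℓ (25 * r) ≤ A * (p (ℓ + 5 * ε) r ^ 5 + 5 * (g r / ε ^ 2)))
    (hscale : ∀ {r ρ} ℓ, 0 < r → 3 * r ≤ ρ → ρ ≤ 75 * r → p ℓ ρ ≤ A * p ℓ r)
    (hg0 : ∀ r, 0 < r → 0 ≤ g r) (hdef : ∀ r, h r = g r * Real.log r ^ (2 + δ))
    (hh0 : ∀ r, 0 < r → 0 < h' r) (hh' : AntitoneOn h' (Ioi 0))
    (hbdd : ∃ C : ℝ, ∀ᶠ r in atTop, h r / h' (25 * r) ≤ C)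
    (hsq : Tendsto (fun r => h' r ^ 2 / h' (5 * r)) atTop (𝓝 0)) {Δ : ℝ} (hΔ : 0 < Δ) :
    ∃ θ > 0, ∃ r₁, ∀ R₀ ≥ r₁, ∀ ℓ, p ℓ R₀ ≤ θ →
      ∃ K, 0 < K ∧ ∀ᶠ R in atTop, p (ℓ - Δ) R ≤ K * h' R := by
  obtain ⟨c, hc, hcsum⟩ := exists_sprinkling hδ hΔ
  obtain ⟨C, hC0, hC⟩ := exists_covariance_rate_bound hdef hh0 hbdd
  set B : ℝ := 5 * C / c ^ 2 with hB
  have hB0 : 0 ≤ B := by positivity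
  set K : ℝ := A * (1 + B) with hK
  have hK1 : 1 ≤ K := by rw [hK]; nlinarith
  have hsmall : ∀ᶠ r in atTop, h' r < 1 / K ^ 5 :=
    (tendsto_rate_zero hh0 hh' hsq).eventually (gt_mem_nhds (by positivity))
  obtain ⟨r₂, hr₂⟩ := eventually_atTop.1 (hC.and ((eventually_pow_four_le hh0 hsq).and hsmall))
  -- The factor `1 / A` pays for passing from `R₀` to the starting scale `ρ`, where the recursion
  -- needs `1 / (2 * K)`.
  refine ⟨1 / (2 * K) / A, by positivity, max r₂ 7, fun R₀ hR₀ ℓ hpR₀ => ⟨K, by linarith, ?_⟩⟩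
  have hR₀7 : 7 ≤ R₀ := (le_max_right _ _).trans hR₀
  have hR₀2 : r₂ ≤ R₀ := (le_max_left _ _).trans hR₀
  obtain ⟨n₀, hn₀⟩ := exists_forall_le_mul_of_pow_five hB0 hA hK (hh0 (75 * R₀) (by linarith))
  filter_upwards [eventually_ge_atTop (75 * R₀ * 25 ^ n₀)] with R hR
  have h25 : (1 : ℝ) ≤ 25 ^ n₀ := one_le_pow₀ (by norm_num)
  have hR3 : 1 ≤ R / (3 * R₀) := by
    rw [le_div_iff₀ (by linarith)]
    nlinarith
  -- Every large `R` is `25 ^ n * ρ` with `ρ` in `[3 R₀, 75 R₀]`. Since `h' ρ ≥ h' (75 R₀)`, the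
  -- number `n₀` of steps needed is uniform in `R`.
  obtain ⟨n, hn1, hn2⟩ := exists_nat_pow_near hR3 (show (1 : ℝ) < 25 by norm_num)
  set ρ : ℝ := R / 25 ^ n with hρ
  have hρR : 25 ^ n * ρ = R := by rw [hρ]; field_simp
  have hρ1 : 3 * R₀ ≤ ρ := by
    rw [le_div_iff₀ (by linarith)] at hn1
    rw [hρ, le_div_iff₀ (by positivity)]
    linarith
  have hρ2 : ρ ≤ 75 * R₀ := by
    rw [div_lt_iff₀ (by linarith), pow_succ] at hn2
    rw [hρ, div_le_iff₀ (by positivity)]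
    linarith
  have hnn : n₀ ≤ n := by
    have h1 : (25 : ℝ) ^ (n₀ + 1) ≤ R / (3 * R₀) := by
      rw [le_div_iff₀ (by linarith), pow_succ]
      linarith
    have := (pow_lt_pow_iff_right₀ (show (1 : ℝ) < 25 by norm_num)).1 (h1.trans_lt hn2)
    omega
  let ε : ℕ → ℝ := fun k => c * ((k : ℝ) + 1) ^ (-(1 + δ / 2))
  let L : ℕ → ℝ := fun k => ℓ - ∑ i ∈ Finset.range k, 5 * ε i
  have hε : ∀ k, 0 < ε k := fun k => by positivity
  have hpow : ∀ k : ℕ, ρ ≤ 25 ^ k * ρ := fun k =>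
    le_mul_of_one_le_left (by linarith) (one_le_pow₀ (by norm_num))
  have hpos : ∀ k : ℕ, 0 < (25 : ℝ) ^ k * ρ := fun k => by linarith [hpow k]
  have hlog : ∀ k : ℕ, (k : ℝ) + 1 ≤ Real.log (25 ^ k * ρ) := fun k => by
    have he := Real.exp_one_lt_d9
    rw [Real.le_log_iff_exp_le (hpos k), Real.exp_add, mul_comm, ← Real.exp_one_pow k, mul_comm]
    gcongr
    · linarith
    · linarith
  -- Here `1 / ε k ^ 2` is `(k + 1) ^ (2 + δ) / c ^ 2`, which the logarithmic factor in `h` absorbs.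
  have hgε : ∀ k, 5 * (g (25 ^ k * ρ) / ε k ^ 2) ≤ B * h' (25 ^ (k + 1) * ρ) := fun k => by
    have h1 := (hr₂ (25 ^ k * ρ) (by linarith [hpow k])).1
    rw [show 25 * (25 ^ k * ρ) = 25 ^ (k + 1) * ρ by ring] at h1
    have hk1 : (0 : ℝ) < (k : ℝ) + 1 := by positivity
    have h2 : g (25 ^ k * ρ) * ((k : ℝ) + 1) ^ (2 + δ) ≤ C * h' (25 ^ (k + 1) * ρ) := by
      refine le_trans ?_ h1
      have := hg0 _ (hpos k)
      gcongr
      exact hlog k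
    have h3 : ε k ^ 2 = c ^ 2 / ((k : ℝ) + 1) ^ (2 + δ) := by
      have : ((k : ℝ) + 1) ^ (2 + δ) = ((((k : ℝ) + 1) ^ (1 + δ / 2))) ^ 2 := by
        rw [← Real.rpow_natCast, ← Real.rpow_mul hk1.le]
        congr 1
        push_cast
        ring
      simp only [ε]
      rw [this, Real.rpow_neg hk1.le, mul_pow, inv_pow]
      exact (div_eq_mul_inv _ _).symm
    rw [h3, div_div_eq_mul_div, hB]
    calc _ ≤ 5 * (C * h' (25 ^ (k + 1) * ρ) / c ^ 2) := by gcongr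
      _ = _ := by ring
  have hfin := hn₀ (fun k => p (L k) (25 ^ k * ρ)) (fun k => h' (25 ^ k * ρ)) (fun k => hp0 _ _)
    (fun k => hh0 _ (hpos k)) ?_ (fun k => ?_) (fun k => ?_) ?_ (fun k => ?_) n hnn
  · rw [hρR] at hfin
    refine le_trans (hmono R ?_) hfin
    have := hcsum n
    simp only [L, ε]
    linarith
  · simp only [pow_zero, one_mul]
    exact hh' (show ρ ∈ Ioi (0 : ℝ) from by simp; linarith)
      (show 75 * R₀ ∈ Ioi (0 : ℝ) from by simp; linarith) hρ2
  · have := (hr₂ (25 ^ k * ρ) (by linarith [hpow k])).2.2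
    rw [lt_div_iff₀ (by positivity)] at this
    linarith
  · have := (hr₂ (25 ^ k * ρ) (by linarith [hpow k])).2.1
    rwa [show 25 * (25 ^ k * ρ) = 25 ^ (k + 1) * ρ by ring] at this
  · have h1 := hscale ℓ (by linarith) hρ1 hρ2
    simp only [pow_zero, one_mul, L, Finset.range_zero, Finset.sum_empty, sub_zero]
    calc p ℓ ρ ≤ A * (1 / (2 * K) / A) := h1.trans (by gcongr)
      _ = 1 / (2 * K) := by field_simp
  · have h1 := hrec (L (k + 1)) (r := 25 ^ k * ρ) (by linarith [hpow k]) (hε k)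
    have h2 : L (k + 1) + 5 * ε k = L k := by
      simp only [L, Finset.sum_range_succ]
      ring
    rw [h2, show 25 * (25 ^ k * ρ) = 25 ^ (k + 1) * ρ by ring] at h1
    refine h1.trans ?_
    have := hgε k
    gcongr

end Recursion
-- Measurability and crossing probabilities at very low levels
section Field

variable {d : ℕ} {T : Space} {Ω : Type*} [MeasurableSpace Ω] {μ : Measure Ω}
  {f : T.pts d → Ω → ℝ}

lemma discreteTopology_lattice (d : ℕ) : DiscreteTopology (Space.lattice.pts d) := by
  refine DiscreteTopology.of_forall_le_dist zero_lt_one fun x y hxy => ?_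
  obtain ⟨i, hi⟩ : ∃ i, x.1 i ≠ y.1 i := by
    by_contra! hcon
    exact hxy (Subtype.ext (PiLp.ext hcon))
  obtain ⟨m, hm⟩ := x.2 i
  obtain ⟨n, hn⟩ := y.2 i
  have h1 : (1 : ℝ) ≤ |x.1 i - y.1 i| := by
    rw [hm, hn] at hi ⊢
    have : m - n ≠ 0 := fun h => hi (by rw [sub_eq_zero.1 h])
    have h : (1 : ℝ) ≤ ((|m - n| : ℤ) : ℝ) := by exact_mod_cast Int.one_le_abs this
    simpa using h
  calc (1 : ℝ) ≤ ‖(x.1 - y.1) i‖ := h1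
    _ ≤ ‖x.1 - y.1‖ := PiLp.norm_apply_le _ i
    _ = dist x y := by rw [Subtype.dist_eq, dist_eq_norm]

lemma ae_continuous (hcont : T = .continuum → ∀ᵐ ω ∂μ, Continuous fun x => f x ω) :
    ∀ᵐ ω ∂μ, Continuous fun x => f x ω := by
  cases T with
  | continuum => exact hcont rfl
  | lattice =>
    have := discreteTopology_lattice d
    exact ae_of_all _ fun ω => continuous_of_discreteTopology

/-- By continuity the supremum is attained along a countable dense subset of the ball. -/
lemma aemeasurable_iSup_ball (hf : ∀ x, AEMeasurable (f x) μ)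
    (hcont : ∀ᵐ ω ∂μ, Continuous fun x => f x ω) (x : T.pts d) :
    AEMeasurable (fun ω => ⨆ y : T.pts d, ⨆ _ : dist y x ≤ 1, ‖f y ω‖ₑ) μ := by
  obtain ⟨D, hDc, hD⟩ := TopologicalSpace.exists_countable_dense {y : T.pts d // dist y x ≤ 1}
  have hm : AEMeasurable (fun ω => ⨆ y ∈ D, ‖f y.1 ω‖ₑ) μ :=
    AEMeasurable.biSup D hDc fun y _ => (hf y.1).enorm
  refine hm.congr ?_
  filter_upwards [hcont] with ω hω
  rw [(iSup_subtype' : (⨆ y : T.pts d, ⨆ _ : dist y x ≤ 1, ‖f y ω‖ₑ) =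
    ⨆ y : {y : T.pts d // dist y x ≤ 1}, ‖f y.1 ω‖ₑ)]
  refine le_antisymm (iSup₂_le fun y _ => le_iSup (fun z : {y : T.pts d // dist y x ≤ 1} =>
    ‖f z.1 ω‖ₑ) y) (iSup_le fun y => ?_)
  have hcl : IsClosed {z : {y : T.pts d // dist y x ≤ 1} | ‖f z.1 ω‖ₑ ≤ ⨆ y ∈ D, ‖f y.1 ω‖ₑ} :=
    isClosed_le (hω.comp continuous_subtype_val).enorm continuous_const
  have hsub : D ⊆ {z : {y : T.pts d // dist y x ≤ 1} | ‖f z.1 ω‖ₑ ≤ ⨆ y ∈ D, ‖f y.1 ω‖ₑ} :=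
    fun z hz => le_iSup₂ (f := fun (y : {y : T.pts d // dist y x ≤ 1}) (_ : y ∈ D) =>
      ‖f y.1 ω‖ₑ) z hz
  exact closure_minimal hsub hcl (by rw [hD.closure_eq]; trivial)

lemma Space.Connects.nonempty {S A B : Set (EuclideanSpace ℝ (Fin d))} (h : T.Connects S A B) :
    S.Nonempty := by
  cases T with
  | lattice =>
    obtain ⟨n, γ, h, -⟩ := h
    exact ⟨γ 0, (h.1 0 (Nat.zero_le n)).2⟩
  | continuum =>
    obtain ⟨a, -, b, -, h⟩ := h
    exact ⟨a, h.source_mem⟩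

/-- A crossing at level `-m` contains a point of `T` near the ball of radius `2 * r` where the field
is at least `m`. Cover by boundedly many unit balls and apply Markov's inequality in each. -/
lemma connProb_le_of_iSup_lintegral_le (hf : ∀ x, AEMeasurable (f x) μ)
    (hcont : ∀ᵐ ω ∂μ, Continuous fun x => f x ω) {H : ℝ≥0∞}
    (hH : ∀ x : T.pts d, ∫⁻ ω, ⨆ y : T.pts d, ⨆ _ : dist y x ≤ 1, ‖f y ω‖ₑ ∂μ ≤ H) (r : ℝ)
    (hr : 0 ≤ r) : ∃ N : ℕ, ∀ m : ℝ, 0 < m → ∀ x, connProb T μ f (-m) (Metric.closedBall x r)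
      (Metric.sphere x (2 * r)) ≤ N * (H / ENNReal.ofReal m) := by
  classical
  obtain ⟨t, ht⟩ := exists_finite_net (d := d) (2 * r + 1) (show (0 : ℝ) < 1 / 2 by norm_num)
  refine ⟨t.card, fun m hm x => ?_⟩
  have h0 : (0 : EuclideanSpace ℝ (Fin d)) ∈ T.pts d := by
    cases T with
    | lattice => exact fun i => ⟨0, by simp⟩
    | continuum => trivial
  -- The moment bound concerns balls centred in `T`, so a net point is replaced by a point of `T`
  -- within `1 / 2`. If there is none, the value `0` is never used.
  let c : EuclideanSpace ℝ (Fin d) → T.pts d := fun v =>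
    if h : ∃ z : T.pts d, dist (z : EuclideanSpace ℝ (Fin d)) v ≤ 1 / 2 then h.choose else ⟨0, h0⟩
  have hc : ∀ (z : T.pts d) v, dist (z : EuclideanSpace ℝ (Fin d)) v ≤ 1 / 2 →
      dist z (c v) ≤ 1 := fun z v hz => by
    have hex : ∃ z : T.pts d, dist (z : EuclideanSpace ℝ (Fin d)) v ≤ 1 / 2 := ⟨z, hz⟩
    have hcv : c v = hex.choose := dif_pos hex
    have := hex.choose_spec
    rw [Subtype.dist_eq, hcv]
    linarith [dist_triangle_right (z : EuclideanSpace ℝ (Fin d)) hex.choose v]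
  have hsub : {ω | T.Connects (excursion T (fun x => f x ω) (-m)) (Metric.closedBall x r)
      (Metric.sphere x (2 * r))} ⊆ ⋃ τ ∈ t, {ω | ENNReal.ofReal m ≤
        ⨆ y : T.pts d, ⨆ _ : dist y (c (x + (1 : ℝ) • τ)) ≤ 1, ‖f y ω‖ₑ} := by
    intro ω hω
    obtain ⟨K, hK, ⟨a, ha, har⟩, ⟨b, hb, hbr⟩⟩ := connects_iff_exists_curve.1
      (show T.Connects _ _ _ from hω)
    rw [Metric.mem_closedBall] at har
    rw [Metric.mem_sphere] at hbr
    obtain ⟨K', hK', -, haK', -⟩ := hK.exists_cut (y := x) (r := 2 * r) ha hb (by linarith) hbr.ge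
    obtain ⟨z, ⟨hz, hfz⟩, hzx⟩ := (connects_iff_exists_curve.2
      ⟨K', hK', ⟨a, haK', mem_univ a⟩, ⟨a, haK', mem_univ a⟩⟩ : T.Connects _ univ univ).nonempty
    obtain ⟨τ, hτ, hzτ⟩ := ht x 1 one_pos z (by simpa using hzx)
    refine mem_biUnion hτ ?_
    have hle : ENNReal.ofReal m ≤ ‖f ⟨z, hz⟩ ω‖ₑ := by
      rw [← ofReal_norm]
      exact ENNReal.ofReal_le_ofReal (by
        have := Real.le_norm_self (f ⟨z, hz⟩ ω)
        linarith)
    exact hle.trans (le_iSup₂ (f := fun (y : T.pts d)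
      (_ : dist y (c (x + (1 : ℝ) • τ)) ≤ 1) => ‖f y ω‖ₑ) ⟨z, hz⟩ (hc _ _ (by simpa using hzτ)))
  calc _ ≤ _ := measure_mono hsub
    _ ≤ ∑ τ ∈ t, μ {ω | ENNReal.ofReal m ≤
        ⨆ y : T.pts d, ⨆ _ : dist y (c (x + (1 : ℝ) • τ)) ≤ 1, ‖f y ω‖ₑ} :=
        measure_biUnion_finset_le _ _
    _ ≤ ∑ _τ ∈ t, H / ENNReal.ofReal m := by
        refine Finset.sum_le_sum fun τ _ => ?_
        refine (meas_ge_le_lintegral_div (aemeasurable_iSup_ball hf hcont _)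
          (by simpa using hm) ENNReal.ofReal_ne_top).trans ?_
        gcongr
        exact hH _
    _ = _ := by rw [Finset.sum_const, nsmul_eq_mul]

/-- The largest probability, over all centres, of crossing the annulus of radii `r` and `2 * r`. -/
noncomputable def crossProb (T : Space) (μ : Measure Ω) (f : T.pts d → Ω → ℝ) (ℓ r : ℝ) : ℝ≥0∞ :=
  ⨆ x : EuclideanSpace ℝ (Fin d),
    connProb T μ f ℓ (Metric.closedBall x r) (Metric.sphere x (2 * r))

lemma crossProb_le_one [IsProbabilityMeasure μ] (ℓ r : ℝ) : crossProb T μ f ℓ r ≤ 1 :=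
  iSup_le fun _ => prob_le_one

lemma crossProb_ne_top [IsProbabilityMeasure μ] (ℓ r : ℝ) : crossProb T μ f ℓ r ≠ ∞ :=
  ((crossProb_le_one ℓ r).trans_lt ENNReal.one_lt_top).ne

lemma crossProb_mono {ℓ ℓ' : ℝ} (h : ℓ ≤ ℓ') (r : ℝ) :
    crossProb T μ f ℓ r ≤ crossProb T μ f ℓ' r :=
  iSup_mono fun _ => connProb_mono h Subset.rfl Subset.rfl

lemma exists_crossProb_le [IsProbabilityMeasure μ] (hf : ∀ x, AEMeasurable (f x) μ)
    (hcont : ∀ᵐ ω ∂μ, Continuous fun x => f x ω)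
    (hsup : (⨆ x : T.pts d, ∫⁻ ω, ⨆ y : T.pts d, ⨆ _ : dist y x ≤ 1, ‖f y ω‖ₑ ∂μ) < ∞)
    {r θ : ℝ} (hr : 0 ≤ r) (hθ : 0 < θ) : ∃ ℓ, (crossProb T μ f ℓ r).toReal ≤ θ := by
  obtain ⟨N, hN⟩ := connProb_le_of_iSup_lintegral_le hf hcont
    (fun x => le_iSup (fun x : T.pts d => ∫⁻ ω, ⨆ y : T.pts d, ⨆ _ : dist y x ≤ 1, ‖f y ω‖ₑ ∂μ) x)
    r hr
  set H := ⨆ x : T.pts d, ∫⁻ ω, ⨆ y : T.pts d, ⨆ _ : dist y x ≤ 1, ‖f y ω‖ₑ ∂μ with hH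
  have hm : 0 < (N * H.toReal + 1) / θ := by positivity
  refine ⟨-((N * H.toReal + 1) / θ), ENNReal.toReal_le_of_le_ofReal hθ.le (iSup_le fun x =>
    (hN _ hm x).trans ?_)⟩
  have e : N * (H / ENNReal.ofReal ((N * H.toReal + 1) / θ)) =
      ENNReal.ofReal (N * (H.toReal / ((N * H.toReal + 1) / θ))) := by
    rw [ENNReal.ofReal_mul (Nat.cast_nonneg N), ENNReal.ofReal_div_of_pos hm,
      ENNReal.ofReal_toReal hsup.ne, ENNReal.ofReal_natCast]
  rw [e]
  refine ENNReal.ofReal_le_ofReal ?_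
  rw [div_div_eq_mul_div, ← mul_div_assoc, div_le_iff₀ (by positivity)]
  nlinarith

end Field

end GaussPerc

/-! ### Proof of the theorem -/

open GaussPerc in
theorem theoremt {d : ℕ} (hd : 2 ≤ d) (T : GaussPerc.Space)
    {Ω : Type*} [MeasurableSpace Ω] (μ : Measure Ω) [IsProbabilityMeasure μ]
    (f : T.pts d → Ω → ℝ)
    -- `f` is a Gaussian field on `T`, continuous if `T = ℝ^d`
    -- (on `ℤ^d` the continuity is automatic, every function being continuous)
    (hf : IsGaussianProcess f μ)
    (hcont : T = GaussPerc.Space.continuum → ∀ᵐ ω ∂μ, Continuous fun x => f x ω)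
    -- uniformly bounded local suprema
    (hsup : (⨆ x : T.pts d, ∫⁻ ω, ⨆ y : T.pts d, ⨆ _ : dist y x ≤ 1, ‖f y ω‖ₑ ∂μ) < ∞)
    -- correlation decay
    (g : ℝ → ℝ) (hg0 : ∀ r, 0 < r → 0 ≤ g r) (hg : AntitoneOn g (Ioi 0))
    (hcov : ∀ x y : T.pts d, x ≠ y → |cov[f x, f y; μ]| ≤ g (dist x y))
    -- the rate functions `h` and `h'`
    (δ : ℝ) (hδ : 0 < δ) (h h' : ℝ → ℝ)
    (hdef : ∀ r, h r = g r * Real.log r ^ (2 + δ))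
    (hh0 : ∀ r, 0 < r → 0 < h' r) (hh' : AntitoneOn h' (Ioi 0))
    (hlim : Tendsto h atTop (𝓝 0))
    (hbdd : ∃ C : ℝ, ∀ᶠ r in atTop, h r / h' (25 * r) ≤ C)
    (hsq : Tendsto (fun r => h' r ^ 2 / h' (5 * r)) atTop (𝓝 0)) :
    ⊥ < GaussPerc.critLevel T μ f ∧
    ∀ ℓ : ℝ, (ℓ : EReal) < GaussPerc.critLevel T μ f →
      ∃ c : ℝ, 0 < c ∧ ∀ R : ℝ, 2 ≤ R →
        (⨆ x : EuclideanSpace ℝ (Fin d),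
          GaussPerc.connProb T μ f ℓ {x} (Metric.sphere x R)) ≤ ENNReal.ofReal (c * h' R) := by
  have hc := ae_continuous hcont
  obtain ⟨N₁, hN₁⟩ := exists_connProb_le_pow d
  obtain ⟨N₂, hN₂⟩ := exists_connProb_le_mul d
  set A : ℝ := N₁ + N₂ + 1 with hA
  have hA1 : 1 ≤ A := by
    rw [hA]
    linarith [Nat.cast_nonneg (α := ℝ) N₁, Nat.cast_nonneg (α := ℝ) N₂]
  have hcov' : ∀ r, 0 < r → ∀ x y : T.pts d, r ≤ dist x y → |cov[f x, f y; μ]| ≤ g r :=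
    fun r hr x y hxy => (hcov x y (dist_pos.1 (hr.trans_le hxy))).trans
      (hg hr (show 0 < dist x y from hr.trans_le hxy) hxy)
  -- The inner radius stays free: `s = 25 * r` gives the recursion, `s = 0` the one-arm event.
  have hstep : ∀ {r s ε : ℝ} (ℓ : ℝ), 7 ≤ r → s ≤ 25 * r → 0 < ε → ∀ x,
      connProb T μ f ℓ (Metric.closedBall x s) (Metric.sphere x (s + 25 * r)) ≤
        ENNReal.ofReal (A * ((crossProb T μ f (ℓ + 5 * ε) r).toReal ^ 5 + 5 * (g r / ε ^ 2))) := by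
    intro r s ε ℓ hr hs hε x
    have hr0 : 0 < r := by linarith
    refine (hN₁ hf hc hr hs (hg0 r hr0) (hcov' r hr0) hε (crossProb_le_one (ℓ + 5 * ε) r)
      (fun y => le_iSup (fun y => connProb T μ f (ℓ + 5 * ε) (Metric.closedBall y r)
        (Metric.sphere y (2 * r))) y) x).trans ?_
    have hg' : 0 ≤ g r / ε ^ 2 := div_nonneg (hg0 r hr0) (by positivity)
    have hp : 0 ≤ (crossProb T μ f (ℓ + 5 * ε) r).toReal ^ 5 := by positivity
    rw [ENNReal.ofReal_mul (by linarith), ENNReal.ofReal_add hp (by positivity),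
      ENNReal.ofReal_pow ENNReal.toReal_nonneg, ENNReal.ofReal_toReal (crossProb_ne_top _ _),
      ENNReal.ofReal_mul (by norm_num)]
    gcongr
    · rw [← ENNReal.ofReal_natCast]
      exact ENNReal.ofReal_le_ofReal (by rw [hA]; linarith [Nat.cast_nonneg (α := ℝ) N₂])
    · simp
  have main := fun (Δ : ℝ) (hΔ : 0 < Δ) => exists_forall_le_rate
    (p := fun ℓ r => (crossProb T μ f ℓ r).toReal) hδ hA1 (fun _ _ => ENNReal.toReal_nonneg)
    (fun r hℓ => ENNReal.toReal_mono (crossProb_ne_top _ _) (crossProb_mono hℓ r))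
    (fun {r ε} ℓ hr hε => by
      have hr0 : 0 < r := by linarith
      have hg' : 0 ≤ g r / ε ^ 2 := div_nonneg (hg0 r hr0) (by positivity)
      refine ENNReal.toReal_le_of_le_ofReal (by positivity) (iSup_le fun x => ?_)
      have := hstep ℓ hr le_rfl hε x
      rwa [← two_mul] at this)
    (fun {r ρ} ℓ hr h3 h75 => by
      refine ENNReal.toReal_le_of_le_ofReal (by positivity) (iSup_le fun x => ?_)
      refine (hN₂ hr h3 h75 (fun y => le_iSup (fun y => connProb T μ f ℓ (Metric.closedBall y r)
        (Metric.sphere y (2 * r))) y) x).trans ?_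
      rw [ENNReal.ofReal_mul (by linarith), ← ENNReal.ofReal_natCast]
      refine mul_le_mul' (ENNReal.ofReal_le_ofReal ?_)
        (ENNReal.ofReal_toReal (crossProb_ne_top _ _)).ge
      rw [hA]; linarith [Nat.cast_nonneg (α := ℝ) N₁])
    hg0 hdef hh0 hh' hbdd hsq hΔ
  refine ⟨?_, fun ℓ hℓ => ?_⟩
  · obtain ⟨θ, hθ, r₁, hr₁⟩ := main 1 one_pos
    obtain ⟨ℓ, hℓ⟩ := exists_crossProb_le hf.aemeasurable hc hsup (le_max_right r₁ 0) hθ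
    obtain ⟨K, hK, hKR⟩ := hr₁ _ (le_max_left r₁ 0) ℓ hℓ
    refine (EReal.bot_lt_coe (ℓ - 1)).trans_le (le_sSup ⟨ℓ - 1, ?_, rfl⟩)
    refine Tendsto.liminf_eq (tendsto_of_tendsto_of_tendsto_of_le_of_le' tendsto_const_nhds
      (h := fun R => ENNReal.ofReal (K * h' R)) ?_ (Eventually.of_forall fun _ => zero_le) ?_)
    · have := ENNReal.tendsto_ofReal ((tendsto_rate_zero hh0 hh' hsq).const_mul K)
      simpa using this
    · filter_upwards [hKR] with R hR
      exact (ENNReal.le_ofReal_iff_toReal_le (crossProb_ne_top _ _)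
        (ENNReal.toReal_nonneg.trans hR)).2 hR
  · obtain ⟨_, ⟨ℓ₁, hℓ₁, rfl⟩, hlt⟩ := lt_sSup_iff.1 hℓ
    have hlt' : ℓ < ℓ₁ := EReal.coe_lt_coe_iff.1 hlt
    -- Half of the gap between the levels is spent on the recursion, the other half, `5 * ε` below,
    -- on the final one-arm step.
    obtain ⟨θ, hθ, r₁, hr₁⟩ := main ((ℓ₁ - ℓ) / 2) (by linarith)
    have hfreq : ∃ᶠ R in atTop, crossProb T μ f ℓ₁ R < ENNReal.ofReal θ :=
      frequently_lt_of_liminf_lt (by isBoundedDefault)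
        (lt_of_eq_of_lt hℓ₁ (ENNReal.ofReal_pos.2 hθ))
    obtain ⟨R₀, hR₀, hR₀r⟩ := (hfreq.and_eventually (eventually_ge_atTop r₁)).exists
    obtain ⟨K, hK, hKR⟩ := hr₁ R₀ hR₀r ℓ₁ (ENNReal.toReal_le_of_le_ofReal hθ.le hR₀.le)
    obtain ⟨C, hC0, hC⟩ := exists_covariance_rate_bound hdef hh0 hbdd
    set ε := (ℓ₁ - ℓ) / 10 with hε
    have hε0 : 0 < ε := by rw [hε]; linarith
    rw [show ℓ₁ - (ℓ₁ - ℓ) / 2 = ℓ + 5 * ε by rw [hε]; ring] at hKR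
    have hbig : ∀ᶠ r in atTop, ∀ x, connProb T μ f ℓ {x} (Metric.sphere x (25 * r)) ≤
        ENNReal.ofReal (A * (K ^ 5 + 5 * C / ε ^ 2) * h' (25 * r)) := by
      filter_upwards [hKR, hC, eventually_pow_four_le hh0 hsq,
        (tendsto_rate_zero hh0 hh' hsq).eventually (gt_mem_nhds zero_lt_one),
        Real.tendsto_log_atTop.eventually_ge_atTop 1, eventually_ge_atTop 7]
        with r hK' hC' h4 h1 hlog h7 x
      have hr0 : 0 < r := by linarith
      have hs := hstep (s := 0) ℓ h7 (by linarith) hε0 x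
      rw [Metric.closedBall_zero, zero_add] at hs
      refine hs.trans (ENNReal.ofReal_le_ofReal ?_)
      have h0 := hh0 r hr0
      have h25 := hh0 (25 * r) (by linarith)
      have hg' : g r ≤ C * h' (25 * r) := by
        refine le_trans ?_ hC'
        exact le_mul_of_one_le_right (hg0 r hr0) (Real.one_le_rpow hlog (by linarith))
      have h5 : (crossProb T μ f (ℓ + 5 * ε) r).toReal ^ 5 ≤ K ^ 5 * h' (25 * r) := by
        calc _ ≤ (K * h' r) ^ 5 := by gcongr
          _ = K ^ 5 * (h' r ^ 4 * h' r) := by ring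
          _ ≤ K ^ 5 * (h' (25 * r) * 1) := by gcongr
          _ = _ := by ring
      calc A * ((crossProb T μ f (ℓ + 5 * ε) r).toReal ^ 5 + 5 * (g r / ε ^ 2))
          ≤ A * (K ^ 5 * h' (25 * r) + 5 * (C * h' (25 * r) / ε ^ 2)) := by gcongr
        _ = _ := by ring
    obtain ⟨r₂, hr₂⟩ := eventually_atTop.1 hbig
    set R₁ := max (25 * r₂) 2 with hR₁
    have hh1 : 0 < h' R₁ := hh0 _ (by linarith [le_max_right (25 * r₂) 2])
    set M := A * (K ^ 5 + 5 * C / ε ^ 2) with hM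
    have hM0 : 0 ≤ M := by positivity
    -- The term `1 / h' R₁` makes the bound at least one, hence trivial, for `R ≤ R₁`.
    refine ⟨M + 1 / h' R₁, by positivity, fun R hR => iSup_le fun x => ?_⟩
    have hR0 := hh0 R (by linarith)
    rcases le_total R₁ R with hle | hle
    · have := hr₂ (R / 25) (by
        rw [le_div_iff₀ (by norm_num)]
        linarith [le_max_left (25 * r₂) 2]) x
      rw [mul_div_cancel₀ R (by norm_num)] at this
      refine this.trans (ENNReal.ofReal_le_ofReal ?_)
      gcongr
      linarith [one_div_pos.2 hh1]
    · refine (prob_le_one).trans ?_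
      rw [ENNReal.one_le_ofReal]
      have hanti : h' R₁ ≤ h' R := hh' (show R ∈ Ioi (0 : ℝ) from by simp; linarith)
        (show R₁ ∈ Ioi (0 : ℝ) from by simp; linarith) hle
      calc 1 = 1 / h' R₁ * h' R₁ := by field_simp
        _ ≤ (M + 1 / h' R₁) * h' R := by gcongr; linarith
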